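/- For a finite poset $P$ and $k\ge 0$ let $c_k(P)$ be the maximal cardinality of a union of $k$ chains of $P$; the shape $\lambda(P)$ is the Young diagram whose $k$-th row has length $c_k(P)-c_{k-1}(P)$, $k\ge 1$. Let $n\ge 0$. For a permutation $\sigma$ of $[n]=\{1,\dots,n\}$ let $P_\sigma=\{(k,\sigma(k)):k\in[n]\}$, ordered by $(k,\sigma(k))\le(l,\sigma(l))$ iff $k\le l$ and $\sigma(k)\le\sigma(l)$, let $P_\sigma[i;j]=\{(k,\sigma(k)): i\le k\le j\}$, and let $\lambda_{[i;j]}=\lambda(P_\sigma[i;j])$. Then: (0) The shapes $\lambda_{[i;j]}$ are well defined, i.e. the numbers $c_k-c_{k-1}$ of $P_\sigma[i;j]$ are the row lengths of a Young diagram. (1) Let $1<i\le j<n$. The shape $\lambda_{[i;j+1]}$ is uniquely determined by $\lambda_{[i-1;j]}$, $\lambda_{[i;j]}$ and $\lambda_{[i-1;j+1]}$, as follows. If there is a shape $\lambda\ne\lambda_{[i-1;j]}$ with $\lambda_{[i;j]}\subsetneq\lambda\subsetneq\lambda_{[i-1;j+1]}$, then $\lambda$ is unique and $\lambda_{[i;j+1]}=\lambda$.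 Otherwise $\lambda_{[i;j+1]}=\lambda_{[i-1;j]}$. (2) There are unique standard Young tableaux $Q(\sigma)$ and $Q'(\sigma)$ with $n$ boxes such that, for $0\le k\le n$, the entries $1,\dots,k$ of $Q(\sigma)$ form the shape $\lambda_{[1;k]}$ and the entries $1,\dots,k$ of $Q'(\sigma)$ form the shape $\lambda_{[n+1-k;n]}$ (empty for $k=0$). Moreover $Q'(\sigma)=Q(\sigma')$, where $\sigma'(i)=n+1-\sigma(n+1-i)$. (3) For a standard Young tableau $T$ with $n$ boxes, let $\Lambda_{[1;j]}$ be the shape formed by the entries $1,\dots,j$ of $T$, let $\Lambda_{[i;i]}$ be a single box, and compute $\Lambda_{[i;j]}$, $1\le i\le j\le n$, recursively by the rule in (1). There is a unique standard Young tableau $\mathrm{ev}(T)$ with $n$ boxes whose entries $1,\dots,k$ form the shape $\Lambda_{[n+1-k;n]}$ for $1\le k\le n$. If $T=Q(\sigma)$, then $\Lambda_{[i;j]}=\lambda_{[i;j]}$ for all $1\le i\le j\le n$, and $\mathrm{ev}(Q(\sigma))=Q'(\sigma)$; in particular $Q'(\sigma)$ depends only on $Q(\sigma)$. The map $T\mapsto\mathrm{ev}(T)$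 (the Schützenberger involution) is a shape-preserving involution on the set of standard Young tableaux with $n$ boxes. -/

import Mathlib

namespace PosetGrowth

/-- For a finite subset `S` of a partially ordered set (a finite poset with the induced order),
`maxChainUnion S k` is the maximal cardinality `c_k` of a union of `k` chains of `S`.
A chain is a totally ordered subset, possibly empty. -/
noncomputable def maxChainUnion {α : Type*} [PartialOrder α] [DecidableEq α]
    (S : Finset α) (k : ℕ) : ℕ :=
  sSup {m : ℕ | ∃ C : Fin k → Finset α,
    (∀ t, C t ⊆ S ∧ IsChain (· ≤ ·) (C t : Set α)) ∧
      m = (Finset.univ.biUnion C).card}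

/-- The number `c_{r+1} - c_r`, the length of row number `r` (counted from `0`) of the shape. -/
noncomputable def chainRow {α : Type*} [PartialOrder α] [DecidableEq α]
    (S : Finset α) (r : ℕ) : ℕ :=
  maxChainUnion S (r + 1) - maxChainUnion S r

open Classical in
/-- The shape of a finite poset `S`: the Young diagram with row lengths
`c_1 - c_0, c_2 - c_1, …`. The clause over all `r ≤ c.1` makes the set of cells a lower set by
construction; it is redundant as soon as `chainRow S` is weakly decreasing. -/
noncomputable def shape {α : Type*} [PartialOrder α] [DecidableEq α]
    (S : Finset α) : YoungDiagram where
  cells := (Finset.range S.card ×ˢ Finset.range S.card).filter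
    fun c => ∀ r ≤ c.1, c.2 < chainRow S r
  isLowerSet := by
    rintro ⟨a, b⟩ ⟨a', b'⟩ h hc
    obtain ⟨h1, h2⟩ := Prod.mk_le_mk.mp h
    simp only [Finset.coe_filter, Finset.mem_product, Finset.mem_range, Set.mem_ofPred_eq] at hc ⊢
    exact ⟨⟨by omega, by omega⟩, fun r hr => lt_of_le_of_lt h2 (hc.2 r (hr.trans h1))⟩

/-- The subposet `P_σ[i;j] = {(k, σ(k)) : i ≤ k ≤ j}` of the permutation poset `P_σ`, which
carries the order induced from the product of two chains with `n` elements. Positions are counted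
from `1`: the element `k : Fin n` is position `k + 1`. -/
def permInterval {n : ℕ} (σ : Equiv.Perm (Fin n)) (i j : ℕ) : Finset (Fin n × Fin n) :=
  (Finset.univ.filter fun k : Fin n => i ≤ (k : ℕ) + 1 ∧ (k : ℕ) + 1 ≤ j).image
    fun k => (k, σ k)

/-- The shape `λ_[i;j]` of `P_σ[i;j]`. -/
noncomputable def intervalShape {n : ℕ} (σ : Equiv.Perm (Fin n)) (i j : ℕ) : YoungDiagram :=
  shape (permInterval σ i j)

/-- The permutation `σ'` with `σ'(i) = n + 1 - σ(n + 1 - i)`. -/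
def rotate {n : ℕ} (σ : Equiv.Perm (Fin n)) : Equiv.Perm (Fin n) :=
  Fin.revPerm * σ * Fin.revPerm

/-- Standard Young tableaux with `n` boxes: fillings of a Young diagram by `1, …, n`, each used
exactly once, increasing along rows and down columns. Outside the diagram `entry` is `0`. -/
@[ext]
structure StandardTableau (n : ℕ) where
  diagram : YoungDiagram
  entry : ℕ × ℕ → ℕ
  bijOn : Set.BijOn entry (diagram.cells : Set (ℕ × ℕ)) (Set.Icc 1 n)
  row_lt : ∀ {r s t : ℕ}, s < t → (r, t) ∈ diagram → entry (r, s) < entry (r, t)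
  col_lt : ∀ {q r s : ℕ}, q < r → (r, s) ∈ diagram → entry (q, s) < entry (r, s)
  zeros : ∀ c : ℕ × ℕ, c ∉ diagram → entry c = 0

namespace StandardTableau

theorem entry_le {n : ℕ} (T : StandardTableau n) {c d : ℕ × ℕ} (h : d ≤ c)
    (hc : c ∈ T.diagram) : T.entry d ≤ T.entry c := by
  obtain ⟨a, b⟩ := c
  obtain ⟨a', b'⟩ := d
  obtain ⟨h1, h2⟩ := Prod.mk_le_mk.mp h
  have hm : (a, b') ∈ T.diagram := T.diagram.up_left_mem le_rfl h2 hc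
  have e1 : T.entry (a', b') ≤ T.entry (a, b') := by
    rcases h1.eq_or_lt with rfl | h1
    · exact le_rfl
    · exact (T.col_lt h1 hm).le
  have e2 : T.entry (a, b') ≤ T.entry (a, b) := by
    rcases h2.eq_or_lt with rfl | h2
    · exact le_rfl
    · exact (T.row_lt h2 hc).le
  exact e1.trans e2

/-- The Young diagram formed by the boxes of `T` with entries `1, …, k`. -/
def sub {n : ℕ} (T : StandardTableau n) (k : ℕ) : YoungDiagram where
  cells := T.diagram.cells.filter fun c => T.entry c ≤ k
  isLowerSet := by
    intro c d h hc
    simp only [Finset.coe_filter, Set.mem_ofPred_eq] at hc ⊢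
    exact ⟨T.diagram.isLowerSet h hc.1, (T.entry_le h hc.1).trans hc.2⟩

/-- `T` encodes the sequence of shapes `μ 0, …, μ n`: for every `k ≤ n`, the entries `1, …, k`
of `T` form the shape `μ k`. -/
def Encodes {n : ℕ} (T : StandardTableau n) (μ : ℕ → YoungDiagram) : Prop :=
  ∀ k ≤ n, T.sub k = μ k

/-- A sequence of shapes is encoded by at most one standard tableau. -/
theorem Encodes.unique {n : ℕ} {T U : StandardTableau n} {μ : ℕ → YoungDiagram}
    (hT : T.Encodes μ) (hU : U.Encodes μ) : T = U := by
  have mem : ∀ (V : StandardTableau n) (k : ℕ) (c : ℕ × ℕ),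
      c ∈ (V.sub k).cells ↔ c ∈ V.diagram.cells ∧ V.entry c ≤ k := by
    intro V k c
    simp [sub]
  have full : ∀ V : StandardTableau n, (V.sub n).cells = V.diagram.cells := by
    intro V
    ext c
    rw [mem]
    exact ⟨fun h => h.1, fun h => ⟨h, (V.bijOn.mapsTo h).2⟩⟩
  have eqs : ∀ k ≤ n, T.sub k = U.sub k := fun k hk => (hT k hk).trans (hU k hk).symm
  have hd : T.diagram = U.diagram := by
    apply YoungDiagram.ext
    rw [← full T, ← full U, eqs n le_rfl]
  have one : ∀ V W : StandardTableau n, (∀ k ≤ n, V.sub k = W.sub k) →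
      ∀ c ∈ V.diagram.cells, W.entry c ≤ V.entry c := by
    intro V W h c hc
    have h1 : c ∈ (V.sub (V.entry c)).cells := (mem V _ c).2 ⟨hc, le_rfl⟩
    rw [h _ (V.bijOn.mapsTo hc).2] at h1
    exact ((mem W _ c).1 h1).2
  refine StandardTableau.ext hd (funext fun c => ?_)
  by_cases hc : c ∈ T.diagram.cells
  · exact le_antisymm (one U T (fun k hk => (eqs k hk).symm) c (hd ▸ hc)) (one T U eqs c hc)
  · rw [T.zeros c hc, U.zeros c (hd ▸ hc)]

end StandardTableau

/-- The Young diagram with a single box. -/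
def oneBox : YoungDiagram where
  cells := {(0, 0)}
  isLowerSet := by
    intro c d h hc
    simp only [Finset.coe_singleton, Set.mem_singleton_iff] at hc ⊢
    subst hc
    exact le_antisymm h ⟨Nat.zero_le _, Nat.zero_le _⟩

open Classical in
/-- The local growth rule: a shape `ν ≠ left` with `bottom ⊊ ν ⊊ top` if there is one, and
`left` otherwise. -/
noncomputable def localRule (left bottom top : YoungDiagram) : YoungDiagram :=
  if h : ∃ ν : YoungDiagram, ν ≠ left ∧ bottom < ν ∧ ν < top then h.choose else left

/-- Row `i` of a triangular array of shapes `λ_[i;j]`, `i ≤ j`, computed from row `i - 1`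
(`prev`): it starts with `λ_[i;i]`, a single box, and continues by the local rule. -/
noncomputable def nextRow (i : ℕ) (prev : ℕ → YoungDiagram) : ℕ → YoungDiagram
  | 0 => ⊥
  | j + 1 =>
    if j + 1 < i then ⊥
    else if j + 1 = i then oneBox
    else localRule (prev j) (nextRow i prev j) (prev (j + 1))

/-- The triangular array with first row `μ 1, μ 2, …`, computed by the local rule. The value at
`(i, j)` is the shape in position `[i;j]`, for `1 ≤ i ≤ j`; it is empty for `i = j + 1 ≥ 2`. -/
noncomputable def growthArray (μ : ℕ → YoungDiagram) : ℕ → ℕ → YoungDiagram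
  | 0 => fun _ => ⊥
  | 1 => μ
  | i + 2 => nextRow (i + 2) (growthArray μ (i + 1))

end PosetGrowth

namespace PosetGrowth

/-! Read $P_\sigma[i;j]$ as the word $\sigma(i)\cdots\sigma(j)$: chains are increasing subsequences,
so the numbers $c_k$ are the Greene invariants of that word. They are unchanged by Knuth
transformations, and row insertion turns a word, up to Knuth equivalence, into the reading word of a
tableau, where the invariants count the cells of the first $k$ rows (for the reversed word:
columns). Hence the shapes are Young diagrams, appending a letter adds one box, and reversing a word
transposes its shape, so prepending a letter also adds one box.

For the local rule take $w=\sigma(i)\cdots\sigma(j)$, $p=\sigma(i-1)$, $q=\sigma(j+1)$. If $p$ and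
$q$ add different boxes to the shape of $w$, the shapes of $pw$ and $wq$ are the only two strictly
between those of $w$ and $pwq$. If they add the same box $c$, it must be shown that no second shape
lies in between, which holds once the last box shares a row or a column with $c$. This is
`aligned_of_cons_eq_append`, by induction on the length: delete the largest letter $m$ and compare
the eight shapes with and without $p$, $q$, $m$. The input is the behaviour of a maximal letter:
where $m$ occupies the very cell that insertion would fill, the insertion bumps $m$ and ends one row
lower (`wordShape_append_of_max`); reversal gives the statement for prepending, with columns.

The involution is then formal. Between shapes that differ by two boxes lie at most two shapes, and
the rule exchanges them or fixes the only one. So the rule is its own inverse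
(`AddBox.localRule_localRule`), and the array started from the last column is the reflected array
(`growthArray_reflect`); its last column is the original first row. -/

section Words

/-! ### Greene invariants of words -/

variable {α : Type*} [LinearOrder α]

/-- The letters of `w` with a color `< k` form `k` increasing subsequences of `w`, one per color. -/
def IsChainColoring (k : ℕ) (w : List α) (g : α → ℕ) : Prop :=
  w.Pairwise fun x y => g x = g y → g x < k → x < y

/-- The maximal number of letters in a union of `k` increasing subsequences of `w`. -/
noncomputable def greene (k : ℕ) (w : List α) : ℕ :=
  sSup {m | ∃ g : α → ℕ, IsChainColoring k w g ∧ w.countP (fun x => g x < k) = m}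

theorem bddAbove_greene (k : ℕ) (w : List α) :
    BddAbove {m | ∃ g : α → ℕ, IsChainColoring k w g ∧ w.countP (fun x => g x < k) = m} :=
  ⟨w.length, by rintro _ ⟨g, -, rfl⟩; exact List.countP_le_length⟩

theorem IsChainColoring.le_greene {k : ℕ} {w : List α} {g : α → ℕ} (h : IsChainColoring k w g) :
    w.countP (fun x => g x < k) ≤ greene k w :=
  le_csSup (bddAbove_greene k w) ⟨g, h, rfl⟩

theorem exists_greene (k : ℕ) (w : List α) :
    ∃ g : α → ℕ, IsChainColoring k w g ∧ w.countP (fun x => g x < k) = greene k w := by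
  refine Nat.sSup_mem (s := {m | ∃ g : α → ℕ, IsChainColoring k w g ∧
    w.countP (fun x => g x < k) = m}) ⟨_, fun _ => k, ?_, rfl⟩ (bddAbove_greene k w)
  exact List.pairwise_iff_forall_sublist.2 fun _ _ h => absurd h (lt_irrefl _)

theorem greene_le_iff {k m : ℕ} {w : List α} :
    greene k w ≤ m ↔ ∀ g, IsChainColoring k w g → w.countP (fun x => g x < k) ≤ m := by
  constructor
  · exact fun h g hg => hg.le_greene.trans h
  · intro h
    obtain ⟨g, hg, e⟩ := exists_greene k w
    exact e ▸ h g hg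

/-- Reversing both the positions and the order of the letters preserves increasing subsequences.
This serves twice: it reduces one Knuth relation to the other, and it gives the shapes of $\sigma'$.
-/
theorem greene_reverse_map {β : Type*} [LinearOrder β] {f : α → β} (hf : StrictAnti f) (k : ℕ)
    (w : List α) : greene k (w.reverse.map f) = greene k w := by
  have key : ∀ g : β → ℕ, IsChainColoring k (w.reverse.map f) g ↔
      IsChainColoring k w (g ∘ f) := by
    intro g
    unfold IsChainColoring
    rw [List.pairwise_map, List.pairwise_reverse]
    simp only [hf.lt_iff_gt, Function.comp]
    constructor <;> exact List.Pairwise.imp fun h e => by simpa [e] using h e.symm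
  apply le_antisymm
  · rw [greene_le_iff]
    intro g hg
    have := ((key g).1 hg).le_greene
    simpa [List.countP_map, Function.comp_def] using this
  · rw [greene_le_iff]
    intro g hg
    cases isEmpty_or_nonempty α with
    | inl h =>
      have : w = [] := List.eq_nil_iff_forall_not_mem.2 fun x => (h.false x).elim
      simp [this]
    | inr h =>
      have e : (g ∘ Function.invFun f) ∘ f = g := by
        funext x
        simp [Function.leftInverse_invFun hf.injective x]
      have := ((key (g ∘ Function.invFun f)).2 (e.symm ▸ hg)).le_greene
      rw [List.countP_map, List.countP_reverse] at this
      refine le_trans (le_of_eq ?_) this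
      congr 1
      funext x
      simp [Function.leftInverse_invFun hf.injective x]

/-- Letters in descending order never share a color below `k`, so the same coloring stays valid
after they are put in ascending order. -/
theorem greene_swap_le {k : ℕ} {a b : List α} {x z : α} (h : x < z) :
    greene k (a ++ [z, x] ++ b) ≤ greene k (a ++ [x, z] ++ b) := by
  rw [greene_le_iff]
  intro g hg
  have : IsChainColoring k (a ++ [x, z] ++ b) g := by
    unfold IsChainColoring at hg ⊢
    simp only [List.append_assoc, List.pairwise_append, List.pairwise_cons, List.cons_append,
      List.nil_append, List.mem_cons] at hg ⊢
    grind
  refine le_trans (le_of_eq ?_) this.le_greene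
  apply List.Perm.countP_eq
  simp only [List.append_assoc]
  exact (List.Perm.append_right b (List.Perm.swap x z [])).append_left a

/-- Only a chain through both `x` and `z` breaks when they are exchanged; the neighbouring letter
`y` allows a repair that keeps the number of colored letters. Distinct letters are needed because
colors belong to letters, not to positions. -/
theorem greene_knuth_le {k : ℕ} {a b : List α} {x y z : α} (hxy : x < y) (hyz : y < z)
    (hn : (a ++ [y, x, z] ++ b).Nodup) :
    greene k (a ++ [y, x, z] ++ b) ≤ greene k (a ++ [y, z, x] ++ b) := by
  rw [greene_le_iff]
  intro g hg
  have perm : (a ++ [y, x, z] ++ b).Perm (a ++ [y, z, x] ++ b) := by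
    simp only [List.append_assoc]
    exact (List.Perm.append_right b ((List.Perm.swap z x []).cons y)).append_left a
  suffices ∃ g', IsChainColoring k (a ++ [y, z, x] ++ b) g' ∧
      (a ++ [y, x, z] ++ b).countP (fun x => g x < k) =
        (a ++ [y, x, z] ++ b).countP (fun x => g' x < k) by
    obtain ⟨g', h', e⟩ := this
    rw [e, perm.countP_eq]
    exact h'.le_greene
  unfold IsChainColoring at hg ⊢
  simp only [List.append_assoc, List.pairwise_append, List.pairwise_cons, List.cons_append,
      List.nil_append, List.mem_cons, List.nodup_append, List.nodup_cons] at hg hn ⊢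
  by_cases hc : g x = g z ∧ g x < k
  swap
  · refine ⟨g, ?_, rfl⟩
    grind
  obtain ⟨hc, hk⟩ := hc
  obtain ⟨ha, ⟨hgy, hgx, hgz, hb⟩, hgab⟩ := hg
  obtain ⟨hna, ⟨hny, hnx, hnz, hnb⟩, hnab⟩ := hn
  by_cases hy : g y < k
  -- If `y` lies on another chain, exchange the tails of the two chains: `y` is now followed by `z`
  -- and its successors, and `x` by the former successors of `y`.
  · refine ⟨fun v => if v = z ∨ v ∈ b then Equiv.swap (g x) (g y) (g v) else g v, ?_, ?_⟩
    · have hne : g y ≠ g x := by grind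
      simp only [Equiv.swap_apply_def]
      refine ⟨ha.imp_of_mem ?_, ⟨?_, ?_, ?_, hb.imp_of_mem ?_⟩, ?_⟩ <;> clear ha hb perm <;>
        intros <;> grind
    · apply List.countP_congr
      intro v _
      simp only [decide_eq_true_eq]
      split_ifs
      · rw [Equiv.swap_apply_def]; split_ifs <;> omega
      · rfl
  -- If `y` lies on no chain, it replaces `x` in the chain through `z`.
  · refine ⟨fun v => if v = x then g y else if v = y then g x else g v, ?_, ?_⟩
    · refine ⟨ha.imp_of_mem ?_, ⟨?_, ?_, ?_, hb.imp_of_mem ?_⟩, ?_⟩ <;> clear ha hb perm <;>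
        intros <;> grind
    · have ht : ∀ l : List α, x ∉ l → y ∉ l → l.countP (fun v => g v < k) =
          l.countP (fun v => (if v = x then g y else if v = y then g x else g v) < k) := by
        intro l hx hy
        apply List.countP_congr
        intro v hv
        have h1 : v ≠ x := by grind
        have h2 : v ≠ y := by grind
        simp [h1, h2]
      rw [List.countP_append, List.countP_append, ht a (by grind) (by grind)]
      simp only [List.countP_cons]
      rw [ht b (by grind) (by grind)]
      have h1 : y ≠ x := by grind
      have h2 : z ≠ y := by grind
      have h3 : z ≠ x := by grind
      simp [h1, h2, h3, hk, hy]

/-! ### Knuth equivalence -/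

/-- The elementary Knuth transformations of words. -/
inductive KnuthStep : List α → List α → Prop
  | left (a b : List α) {x y z : α} : x < y → y < z →
      KnuthStep (a ++ [y, x, z] ++ b) (a ++ [y, z, x] ++ b)
  | right (a b : List α) {x y z : α} : x < y → y < z →
      KnuthStep (a ++ [x, z, y] ++ b) (a ++ [z, x, y] ++ b)

/-- Knuth equivalence of words. -/
def KnuthEquiv : List α → List α → Prop :=
  Relation.EqvGen KnuthStep

theorem KnuthStep.equiv {u v : List α} (h : KnuthStep u v) : KnuthEquiv u v :=
  Relation.EqvGen.rel _ _ h

theorem KnuthStep.perm {u v : List α} (h : KnuthStep u v) : u.Perm v := by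
  cases h with
  | left a b =>
    simp only [List.append_assoc]
    exact (List.Perm.append_right b ((List.Perm.swap _ _ []).cons _)).append_left a
  | right a b =>
    simp only [List.append_assoc]
    exact (List.Perm.append_right b (List.Perm.swap _ _ _)).append_left a

theorem KnuthStep.append_append {u v : List α} (h : KnuthStep u v) (c d : List α) :
    KnuthStep (c ++ u ++ d) (c ++ v ++ d) := by
  cases h with
  | left a b h1 h2 => simpa using KnuthStep.left (c ++ a) (b ++ d) h1 h2
  | right a b h1 h2 => simpa using KnuthStep.right (c ++ a) (b ++ d) h1 h2

theorem KnuthStep.reverse {u v : List α} (h : KnuthStep u v) :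
    KnuthStep v.reverse u.reverse := by
  cases h with
  | left a b h1 h2 => simpa using KnuthStep.right b.reverse a.reverse h1 h2
  | right a b h1 h2 => simpa using KnuthStep.left b.reverse a.reverse h1 h2

theorem strictAnti_toDual (α : Type*) [Preorder α] : StrictAnti (OrderDual.toDual (α := α)) :=
  fun _ _ h => h

theorem KnuthStep.greene_eq {u v : List α} (h : KnuthStep u v) (hu : u.Nodup) (k : ℕ) :
    greene k u = greene k v := by
  cases h with
  | @left a b x y z h1 h2 =>
    refine le_antisymm (greene_knuth_le h1 h2 hu) ?_
    simpa using greene_swap_le (k := k) (a := a ++ [y]) (b := b) (h1.trans h2)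
  | @right a b x y z h1 h2 =>
    refine le_antisymm ?_ ?_
    -- The second Knuth relation is the first one for the reversed word in the dual order, with `x`
    -- and `z` interchanged.
    · have := greene_knuth_le (α := αᵒᵈ) (k := k) (a := b.reverse.map OrderDual.toDual)
        (b := a.reverse.map OrderDual.toDual) (x := OrderDual.toDual z) (y := OrderDual.toDual y)
        (z := OrderDual.toDual x) h2 h1 (by
          have := (List.nodup_reverse.2 hu).map (OrderDual.toDual (α := α)).injective
          simpa using this)
      rw [← greene_reverse_map (strictAnti_toDual α),
        ← greene_reverse_map (strictAnti_toDual α) k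
          (a ++ [z, x, y] ++ b)]
      simpa using this
    · simpa using greene_swap_le (k := k) (a := a) (b := y :: b) (h1.trans h2)

/-- Either all three letters survive and the step remains, or the largest, `z`, disappears and both
sides become equal. -/
theorem KnuthStep.filter_lt {u v : List α} (h : KnuthStep u v) (m : α) :
    KnuthEquiv (u.filter (· < m)) (v.filter (· < m)) := by
  cases h with
  | @left a b x y z h1 h2 =>
    by_cases hz : z < m
    · have hy := h2.trans hz
      have hx := h1.trans hy
      simpa [hx, hy, hz] using (KnuthStep.left (a.filter (· < m)) (b.filter (· < m)) h1 h2).equiv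
    · have : (a ++ [y, x, z] ++ b).filter (· < m) = (a ++ [y, z, x] ++ b).filter (· < m) := by
        simp only [List.filter_append, List.filter_cons, hz]
        simp
      rw [this]
      exact Relation.EqvGen.refl _
  | @right a b x y z h1 h2 =>
    by_cases hz : z < m
    · have hy := h2.trans hz
      have hx := h1.trans hy
      simpa [hx, hy, hz] using (KnuthStep.right (a.filter (· < m)) (b.filter (· < m)) h1 h2).equiv
    · have : (a ++ [x, z, y] ++ b).filter (· < m) = (a ++ [z, x, y] ++ b).filter (· < m) := by
        simp only [List.filter_append, List.filter_cons, hz]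
        simp
      rw [this]
      exact Relation.EqvGen.refl _

namespace KnuthEquiv

theorem refl (u : List α) : KnuthEquiv u u := Relation.EqvGen.refl u

theorem symm {u v : List α} (h : KnuthEquiv u v) : KnuthEquiv v u := Relation.EqvGen.symm _ _ h

theorem trans {u v w : List α} (h : KnuthEquiv u v) (h' : KnuthEquiv v w) : KnuthEquiv u w :=
  Relation.EqvGen.trans _ _ _ h h'

theorem perm {u v : List α} (h : KnuthEquiv u v) : u.Perm v := by
  induction h with
  | rel _ _ h => exact h.perm
  | refl _ => exact List.Perm.refl _
  | symm _ _ _ ih => exact ih.symm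
  | trans _ _ _ _ _ ih1 ih2 => exact ih1.trans ih2

theorem append_append {u v : List α} (h : KnuthEquiv u v) (c d : List α) :
    KnuthEquiv (c ++ u ++ d) (c ++ v ++ d) := by
  induction h with
  | rel _ _ h => exact Relation.EqvGen.rel _ _ (h.append_append c d)
  | refl _ => exact refl _
  | symm _ _ _ ih => exact ih.symm
  | trans _ _ _ _ _ ih1 ih2 => exact ih1.trans ih2

theorem append_right {u v : List α} (h : KnuthEquiv u v) (d : List α) :
    KnuthEquiv (u ++ d) (v ++ d) := by
  simpa using h.append_append [] d

theorem append_left {u v : List α} (h : KnuthEquiv u v) (c : List α) :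
    KnuthEquiv (c ++ u) (c ++ v) := by
  simpa using h.append_append c []

theorem reverse {u v : List α} (h : KnuthEquiv u v) : KnuthEquiv u.reverse v.reverse := by
  induction h with
  | rel _ _ h => exact (Relation.EqvGen.rel _ _ h.reverse).symm
  | refl _ => exact refl _
  | symm _ _ _ ih => exact ih.symm
  | trans _ _ _ _ _ ih1 ih2 => exact ih1.trans ih2

theorem filter_lt {u v : List α} (h : KnuthEquiv u v) (m : α) :
    KnuthEquiv (u.filter (· < m)) (v.filter (· < m)) := by
  induction h with
  | rel _ _ h => exact h.filter_lt m
  | refl _ => exact refl _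
  | symm _ _ _ ih => exact ih.symm
  | trans _ _ _ _ _ ih1 ih2 => exact ih1.trans ih2

theorem greene_eq {u v : List α} (h : KnuthEquiv u v) (hu : u.Nodup) (k : ℕ) :
    greene k u = greene k v := by
  induction h with
  | rel _ _ h => exact h.greene_eq hu k
  | refl _ => rfl
  | symm _ _ h ih => exact (ih ((perm h).nodup_iff.2 hu)).symm
  | trans _ _ _ h _ ih1 ih2 => exact (ih1 hu).trans (ih2 ((perm h).nodup_iff.1 hu))

theorem append_smaller {y x : α} (hx : x < y) {l : List α} (hl : (y :: l).Pairwise (· < ·)) :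
    KnuthEquiv (y :: l ++ [x]) (y :: x :: l) := by
  induction l generalizing y with
  | nil => exact refl _
  | cons b l ih =>
    rw [List.pairwise_cons] at hl
    have hb := hl.1 b List.mem_cons_self
    refine ((ih (hx.trans hb) hl.2).append_left [y]).trans ?_
    simpa using (KnuthStep.left [] l hx hb).equiv.symm

theorem move_left {y x : α} (hx : x < y) {l : List α} (hl : (l ++ [x]).Pairwise (· < ·))
    (r : List α) : KnuthEquiv (l ++ y :: x :: r) (y :: l ++ x :: r) := by
  induction l with
  | nil => exact refl _
  | cons a l ih =>
    rw [List.cons_append, List.pairwise_cons] at hl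
    refine ((ih hl.2).append_left [a]).trans ?_
    cases l with
    | nil => simpa using (KnuthStep.right [] r (hl.1 x (by simp)) hx).equiv
    | cons b l =>
      have hbx : b < x := (List.pairwise_append.1 hl.2).2.2 b (by simp) x (by simp)
      simpa using (KnuthStep.right [] (l ++ x :: r) (hl.1 b (by simp)) (hbx.trans hx)).equiv

/-- Row insertion into one row: `x` travels left until it stands just after `y`, then `y` travels
left out of the row. -/
theorem bump {y x : α} (hx : x < y) {l r : List α} (hl : ∀ a ∈ l, a < x)
    (h : (l ++ y :: r).Pairwise (· < ·)) :
    KnuthEquiv (l ++ y :: r ++ [x]) (y :: l ++ x :: r) := by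
  rw [List.pairwise_append] at h
  rw [List.append_assoc]
  refine ((append_smaller hx h.2.1).append_left l).trans (move_left hx ?_ r)
  rw [List.pairwise_append]
  exact ⟨h.1, by simp, by simpa using hl⟩

end KnuthEquiv

/-! ### Tableaux and row insertion -/

/-- The row reading word, from the last row to the first row. -/
def tabWord : List (List α) → List α
  | [] => []
  | R :: T => tabWord T ++ R

/-- `RowInsert T x T' r`: row insertion of `x` into the tableau `T` with rows in a list gives `T'`,
with one more letter in row `r`. -/
inductive RowInsert : List (List α) → α → List (List α) → ℕ → Prop
  | nil (x : α) : RowInsert [] x [[x]] 0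
  | last {R : List α} (T : List (List α)) {x : α} :
      (∀ a ∈ R, a < x) → RowInsert (R :: T) x ((R ++ [x]) :: T) 0
  | bump {T U : List (List α)} {l : List α} {x y : α} (s : List α) {r : ℕ} :
      (∀ a ∈ l, a < x) → x < y → RowInsert T y U r →
      RowInsert ((l ++ y :: s) :: T) x ((l ++ x :: s) :: U) (r + 1)

/-- The row `S` fits below the row `R`: columns increase strictly. -/
def FitsBelow : List α → List α → Prop
  | _, [] => True
  | [], _ :: _ => False
  | r :: R, s :: S => r < s ∧ FitsBelow R S

/-- A list of rows is a tableau: rows and columns increase strictly. Rows may be empty. -/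
def IsTab : List (List α) → Prop
  | [] => True
  | R :: T => R.Pairwise (· < ·) ∧ FitsBelow R (T.headD []) ∧ IsTab T

@[simp]
theorem fitsBelow_nil (R : List α) : FitsBelow R [] := by
  cases R <;> trivial

theorem FitsBelow.append {R S : List α} (h : FitsBelow R S) (l : List α) :
    FitsBelow (R ++ l) S := by
  induction R generalizing S with
  | nil => cases S with
    | nil => simp
    | cons s S => exact h.elim
  | cons r R ih => cases S with
    | nil => simp
    | cons s S => exact ⟨h.1, ih h.2⟩

theorem FitsBelow.of_append {R S l : List α} (h : FitsBelow R (S ++ l)) :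
    FitsBelow R S := by
  induction R generalizing S with
  | nil => cases S with
    | nil => simp
    | cons s S => exact h.elim
  | cons r R ih => cases S with
    | nil => simp
    | cons s S => exact ⟨h.1, ih h.2⟩

theorem FitsBelow.of_append_max {R S : List α} {m : α} (h : FitsBelow (R ++ [m]) S)
    (hS : ∀ s ∈ S, s < m) : FitsBelow R S := by
  induction R generalizing S with
  | nil => cases S with
    | nil => simp
    | cons s S => exact absurd h.1 (hS s (by simp)).asymm
  | cons r R ih => cases S with
    | nil => simp
    | cons s S => exact ⟨h.1, ih h.2 fun t ht => hS t (by simp [ht])⟩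

theorem FitsBelow.replace {l s S : List α} {x y : α} (h : FitsBelow (l ++ y :: s) S)
    (hx : x < y) : FitsBelow (l ++ x :: s) S := by
  induction l generalizing S with
  | nil => cases S with
    | nil => simp
    | cons t S => exact ⟨hx.trans h.1, h.2⟩
  | cons r R ih => cases S with
    | nil => simp
    | cons t S => exact ⟨h.1, ih h.2⟩

theorem FitsBelow.getElem {R S : List α} (h : FitsBelow R S) (i : ℕ) (hi : i < S.length) :
    ∃ h' : i < R.length, R[i] < S[i] := by
  induction R generalizing S i with
  | nil => cases S with
    | nil => simp at hi
    | cons s S => exact h.elim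
  | cons r R ih => cases S with
    | nil => simp at hi
    | cons s S => cases i with
      | zero => exact ⟨by simp, h.1⟩
      | succ i =>
        obtain ⟨h1, h2⟩ := ih h.2 i (by simpa using hi)
        exact ⟨by simpa using h1, by simpa using h2⟩

theorem FitsBelow.bump_last {l s S : List α} {x y : α} (h : FitsBelow (l ++ y :: s) S)
    (hl : ∀ a ∈ l, a < x) (hx : x < y) (hS : ∀ a ∈ S, a < y) :
    FitsBelow (l ++ x :: s) (S ++ [y]) := by
  induction l generalizing S with
  | nil => cases S with
    | nil => exact ⟨hx, by simp⟩
    | cons t S => exact absurd h.1 (hS t (by simp)).asymm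
  | cons r l ih => cases S with
    | nil => exact ⟨(hl r (by simp)).trans hx, by simp⟩
    | cons t S => exact ⟨h.1, ih h.2 (fun a ha => hl a (by simp [ha]))
        fun a ha => hS a (by simp [ha])⟩

/-- The entry under the old place of `y` exceeds `y`, so `y` lands in the next row weakly to the
left of the column it came from; there the entry above it is at most `x`. -/
theorem FitsBelow.bump_bump {l s l' s' : List α} {x y z : α}
    (h : FitsBelow (l ++ y :: s) (l' ++ z :: s'))
    (hl : ∀ a ∈ l, a < x) (hx : x < y) (hl' : ∀ a ∈ l', a < y) :
    FitsBelow (l ++ x :: s) (l' ++ y :: s') := by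
  induction l generalizing l' with
  | nil => cases l' with
    | nil => exact ⟨hx, h.2⟩
    | cons t l' => exact absurd h.1 (hl' t (by simp)).asymm
  | cons r l ih => cases l' with
    | nil => exact ⟨(hl r (by simp)).trans hx, h.2.replace hx⟩
    | cons t l' => exact ⟨h.1, ih h.2 (fun a ha => hl a (by simp [ha]))
        fun a ha => hl' a (by simp [ha])⟩

theorem exists_split_of_pairwise {R : List α} (hR : R.Pairwise (· < ·)) {x : α} (hx : x ∉ R) :
    (∀ a ∈ R, a < x) ∨ ∃ l y s, R = l ++ y :: s ∧ (∀ a ∈ l, a < x) ∧ x < y := by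
  induction R with
  | nil => simp
  | cons r R ih =>
    rw [List.pairwise_cons] at hR
    rcases lt_trichotomy r x with h | h | h
    · rcases ih hR.2 (fun h => hx (by simp [h])) with h' | ⟨l, y, s, rfl, h1, h2⟩
      · left; simpa [h] using h'
      · right; exact ⟨r :: l, y, s, rfl, by simpa [h] using h1, h2⟩
    · exact absurd (by simp [h]) hx
    · right; exact ⟨[], r, R, rfl, by simp, h⟩

theorem RowInsert.exists {T : List (List α)} (hT : IsTab T) {x : α} (hx : x ∉ tabWord T)
    (hn : (tabWord T).Nodup) : ∃ T' r, RowInsert T x T' r := by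
  induction T generalizing x with
  | nil => exact ⟨_, _, RowInsert.nil x⟩
  | cons R T ih =>
    simp only [tabWord, List.mem_append, not_or, List.nodup_append] at hx hn
    rcases exists_split_of_pairwise hT.1 hx.2 with h | ⟨l, y, s, rfl, h1, h2⟩
    · exact ⟨_, _, RowInsert.last T h⟩
    · obtain ⟨T', r, h⟩ := ih hT.2.2 (fun h => hn.2.2 y h y (by simp) rfl) hn.1
      exact ⟨_, _, RowInsert.bump s h1 h2 h⟩

theorem RowInsert.isTab {T T' : List (List α)} {x : α} {r : ℕ} (h : RowInsert T x T' r)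
    (hT : IsTab T) : IsTab T' := by
  induction h with
  | nil x => simp [IsTab]
  | last T h =>
    refine ⟨?_, hT.2.1.append _, hT.2.2⟩
    rw [List.pairwise_append]
    exact ⟨hT.1, by simp, by simpa using h⟩
  | @bump T T' l x y s r h1 h2 h ih =>
    refine ⟨?_, ?_, ih hT.2.2⟩
    · have := hT.1
      rw [List.pairwise_append, List.pairwise_cons] at this ⊢
      refine ⟨this.1, ⟨fun a ha => h2.trans (this.2.1.1 a ha), this.2.1.2⟩, ?_⟩
      intro a ha b hb
      rw [List.mem_cons] at hb
      rcases hb with rfl | hb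
      · exact h1 a ha
      · exact this.2.2 a ha b (by simp [hb])
    · have hf := hT.2.1
      cases h with
      | nil => exact FitsBelow.bump_last (S := []) (by simp) h1 h2 (by simp)
      | last T h => exact hf.bump_last h1 h2 h
      | bump s' h3 h4 _ => exact FitsBelow.bump_bump hf h1 h2 h3

theorem RowInsert.knuthEquiv {T T' : List (List α)} {x : α} {r : ℕ} (h : RowInsert T x T' r)
    (hT : IsTab T) : KnuthEquiv (tabWord T ++ [x]) (tabWord T') := by
  induction h with
  | nil x => exact KnuthEquiv.refl _
  | last T h => simpa [tabWord] using KnuthEquiv.refl _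
  | @bump T T' l x y s r h1 h2 h ih =>
    have e1 := (KnuthEquiv.bump h2 h1 hT.1).append_left (tabWord T)
    have e2 := (ih hT.2.2).append_right (l ++ x :: s)
    simp only [tabWord, List.append_assoc, List.cons_append, List.nil_append] at e1 e2 ⊢
    exact e1.trans e2

theorem RowInsert.length_getD {T T' : List (List α)} {x : α} {r : ℕ} (h : RowInsert T x T' r)
    (i : ℕ) : (T'.getD i []).length = (T.getD i []).length + if i = r then 1 else 0 := by
  induction h generalizing i with
  | nil x => cases i <;> simp
  | last T h => cases i <;> simp
  | bump s h1 h2 h ih => cases i with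
    | zero => simp
    | succ i => simpa using ih i

theorem exists_tab (w : List α) (hw : w.Nodup) :
    ∃ T, IsTab T ∧ KnuthEquiv w (tabWord T) := by
  induction w using List.reverseRecOn with
  | nil => exact ⟨[], trivial, KnuthEquiv.refl _⟩
  | append_singleton w x ih =>
    rw [List.nodup_append] at hw
    obtain ⟨T, hT, h⟩ := ih hw.1
    obtain ⟨T', r, hi⟩ := RowInsert.exists hT (x := x)
      (fun hx => hw.2.2 x (h.perm.mem_iff.2 hx) x (by simp) rfl) (h.perm.nodup_iff.1 hw.1)
    exact ⟨T', hi.isTab hT, (h.append_right _).trans (hi.knuthEquiv hT)⟩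

/-! ### Greene's theorem: the shape of a word -/

/-- The word `w` has shape `μ`: unions of `k` increasing subsequences are measured by the first `k`
rows of `μ`, and unions of `k` decreasing subsequences by the first `k` columns. -/
def HasShape (w : List α) (μ : YoungDiagram) : Prop :=
  (∀ k, greene k w = (μ.cells.filter (fun c => c.1 < k)).card) ∧
    ∀ k, greene k w.reverse = (μ.cells.filter (fun c => c.2 < k)).card

theorem countP_eq_card {w : List α} (hw : w.Nodup) (p : α → Prop) [DecidablePred p] :
    w.countP (fun x => p x) = (w.toFinset.filter p).card := by
  rw [List.countP_eq_length_filter, ← List.toFinset_card_of_nodup (hw.filter _),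
    List.toFinset_filter]
  simp

/-- The first `k` rows are `k` chains. Conversely, a column is a decreasing subsequence and meets
each chain at most once, so column $j$ contributes at most $\min(k,\text{its length})$ letters to
`k` chains, which is its share of the first `k` rows. -/
theorem greene_eq_of_bijOn {w : List α} (hw : w.Nodup) {μ : YoungDiagram} {pos : α → ℕ × ℕ}
    (hpos : Set.BijOn pos {x | x ∈ w} μ.cells)
    (hrow : w.Pairwise fun x y => (pos x).1 = (pos y).1 → x < y)
    (hcol : w.Pairwise fun x y => (pos x).2 = (pos y).2 → y < x) (k : ℕ) :
    greene k w = (μ.cells.filter (fun c => c.1 < k)).card := by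
  have e : w.countP (fun x => (pos x).1 < k) = (μ.cells.filter (fun c => c.1 < k)).card := by
    rw [countP_eq_card hw]
    apply Finset.card_bij (fun x _ => pos x)
    · intro x hx
      simp only [Finset.mem_filter, List.mem_toFinset] at hx ⊢
      exact ⟨hpos.mapsTo hx.1, hx.2⟩
    · intro x hx y hy h
      simp only [Finset.mem_filter, List.mem_toFinset] at hx hy
      exact hpos.injOn hx.1 hy.1 h
    · intro c hc
      simp only [Finset.mem_filter] at hc
      obtain ⟨x, hx, rfl⟩ := hpos.surjOn hc.1
      exact ⟨x, by simpa using ⟨hx, hc.2⟩, rfl⟩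
  apply le_antisymm
  · rw [greene_le_iff]
    intro g hg
    rw [← e, countP_eq_card hw, countP_eq_card hw]
    rw [Finset.card_eq_sum_card_fiberwise (f := fun x => (pos x).2)
      (t := w.toFinset.image fun x => (pos x).2) (s := w.toFinset.filter fun x => g x < k),
      Finset.card_eq_sum_card_fiberwise (f := fun x => (pos x).2)
      (t := w.toFinset.image fun x => (pos x).2)
      (s := w.toFinset.filter fun x => (pos x).1 < k)]
    rotate_left
    · intro x hx
      simp only [Finset.coe_filter, List.mem_toFinset, Set.mem_ofPred_eq] at hx
      exact Finset.mem_image_of_mem _ (by simpa using hx.1)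
    · intro x hx
      simp only [Finset.coe_filter, List.mem_toFinset, Set.mem_ofPred_eq] at hx
      exact Finset.mem_image_of_mem _ (by simpa using hx.1)
    apply Finset.sum_le_sum
    intro j _
    -- A short column lies entirely in the first `k` rows. In a long one, the first `k` rows hold at
    -- least `k` letters, and the colors are injective on the colored letters.
    by_cases hj : μ.colLen j ≤ k
    · apply Finset.card_le_card
      intro x hx
      simp only [Finset.mem_filter, List.mem_toFinset] at hx ⊢
      refine ⟨⟨hx.1.1, ?_⟩, hx.2⟩
      have : pos x ∈ μ := hpos.mapsTo hx.1.1
      have h2 : ((pos x).1, (pos x).2) ∈ μ := this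
      rw [YoungDiagram.mem_iff_lt_colLen, hx.2] at h2
      omega
    · have h1 : k ≤ ((w.toFinset.filter fun x => (pos x).1 < k).filter
          fun x => (pos x).2 = j).card := by
        have hs : ∀ i < k, ∃ x, x ∈ w ∧ pos x = (i, j) := by
          intro i hi
          have : (i, j) ∈ μ := by
            rw [YoungDiagram.mem_iff_lt_colLen]
            omega
          obtain ⟨x, hx, h⟩ := hpos.surjOn this
          exact ⟨x, hx, h⟩
        have hs : ∀ i, ∃ x, i < k → x ∈ w ∧ pos x = (i, j) := by
          intro i
          by_cases hi : i < k
          · obtain ⟨x, hx⟩ := hs i hi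
            exact ⟨x, fun _ => hx⟩
          · obtain ⟨x, -⟩ := hpos.surjOn (show (0, j) ∈ μ from
              YoungDiagram.mem_iff_lt_colLen.2 (by omega))
            exact ⟨x, fun h => absurd h hi⟩
        choose f hf using hs
        conv_lhs => rw [← Finset.card_range k]
        apply Finset.card_le_card_of_injOn f
        · intro i hi
          have hi : i < k := by simpa using hi
          simp only [Finset.coe_filter, Finset.mem_filter, List.mem_toFinset, Set.mem_ofPred_eq]
          rw [(hf i hi).2]
          exact ⟨⟨(hf i hi).1, hi⟩, rfl⟩
        · intro i hi i' hi' h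
          have hi : i < k := by simpa using hi
          have hi' : i' < k := by simpa using hi'
          have := (hf i hi).2
          rw [h, (hf i' hi').2] at this
          simpa using this.symm
      refine le_trans ?_ h1
      conv_rhs => rw [← Finset.card_range k]
      apply Finset.card_le_card_of_injOn g
      · intro x hx
        simp only [Finset.coe_filter, Finset.mem_filter, List.mem_toFinset,
          Set.mem_ofPred_eq] at hx
        simpa using hx.1.2
      · intro x hx y hy h
        simp only [Finset.coe_filter, Finset.mem_filter, List.mem_toFinset,
          Set.mem_ofPred_eq] at hx hy
        by_contra hne
        have key := ((hg.and hcol).imp (S := fun x y => ¬ (g x = g y ∧ g x < k ∧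
          (pos x).2 = (pos y).2)) fun h h' => (h.1 h'.1 h'.2.1).asymm (h.2 h'.2.2))
        have : Std.Symm fun x y => ¬ (g x = g y ∧ g x < k ∧ (pos x).2 = (pos y).2) :=
          ⟨fun x y h h' => h ⟨h'.1.symm, h'.1 ▸ h'.2.1, h'.2.2.symm⟩⟩
        exact key.forall hx.1.1 hy.1.1 hne ⟨h, hx.1.2, hx.2.trans hy.2.symm⟩
  · rw [← e]
    refine IsChainColoring.le_greene (g := fun x => (pos x).1) ?_
    exact hrow.imp fun h e _ => h e

theorem HasShape.of_bijOn {w : List α} (hw : w.Nodup) {μ : YoungDiagram} {pos : α → ℕ × ℕ}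
    (hpos : Set.BijOn pos {x | x ∈ w} μ.cells)
    (hrow : w.Pairwise fun x y => (pos x).1 = (pos y).1 → x < y)
    (hcol : w.Pairwise fun x y => (pos x).2 = (pos y).2 → y < x) : HasShape w μ := by
  refine ⟨greene_eq_of_bijOn hw hpos hrow hcol, fun k => ?_⟩
  have h := greene_eq_of_bijOn (w := w.reverse) (List.nodup_reverse.2 hw) (μ := μ.transpose)
    (pos := fun x => (pos x).swap) ?_ ?_ ?_ k
  · rw [h]
    apply Finset.card_bij (fun c _ => c.swap)
    · intro c hc
      simp only [Finset.mem_filter, YoungDiagram.mem_cells, YoungDiagram.mem_transpose] at hc ⊢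
      exact hc
    · intro c _ d _ h
      exact Prod.swap_injective h
    · intro c hc
      simp only [Finset.mem_filter, YoungDiagram.mem_cells] at hc
      exact ⟨c.swap, by simpa using hc, by simp⟩
  · refine ⟨?_, ?_, ?_⟩
    · intro x hx
      have := hpos.mapsTo (show x ∈ {x | x ∈ w} by simpa using hx)
      simpa using this
    · intro x hx y hy h
      exact hpos.injOn (by simpa using hx) (by simpa using hy) (Prod.swap_injective h)
    · intro c hc
      have : c.swap ∈ (μ.cells : Set (ℕ × ℕ)) := by simpa using hc
      obtain ⟨x, hx, h⟩ := hpos.surjOn this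
      exact ⟨x, by simpa using hx, by simp [h]⟩
  · rw [List.pairwise_reverse]
    exact hcol.imp fun h e => h e.symm
  · rw [List.pairwise_reverse]
    exact hrow.imp fun h e => h e.symm

theorem card_filter_lt_succ (μ : YoungDiagram) (k : ℕ) :
    (μ.cells.filter (fun c => c.1 < k + 1)).card =
      (μ.cells.filter (fun c => c.1 < k)).card + μ.rowLen k := by
  rw [YoungDiagram.rowLen_eq_card, YoungDiagram.row, ← Finset.card_union_of_disjoint]
  · congr 1
    ext c
    simp only [Finset.mem_filter, Finset.mem_union]
    grind
  · rw [Finset.disjoint_filter]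
    omega

theorem ext_rowLen {μ ν : YoungDiagram} (h : ∀ i, μ.rowLen i = ν.rowLen i) : μ = ν := by
  apply YoungDiagram.ext
  ext ⟨i, j⟩
  rw [YoungDiagram.mem_cells, YoungDiagram.mem_cells, YoungDiagram.mem_iff_lt_rowLen,
    YoungDiagram.mem_iff_lt_rowLen, h]

theorem HasShape.greene_succ {w : List α} {μ : YoungDiagram} (h : HasShape w μ) (k : ℕ) :
    greene (k + 1) w = greene k w + μ.rowLen k := by
  rw [h.1, h.1, card_filter_lt_succ]

theorem HasShape.unique {w : List α} {μ ν : YoungDiagram} (h : HasShape w μ) (h' : HasShape w ν) :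
    μ = ν :=
  ext_rowLen fun i => by
    have h1 := h.greene_succ i
    have h2 := h'.greene_succ i
    omega

theorem HasShape.reverse {w : List α} {μ : YoungDiagram} (h : HasShape w μ) :
    HasShape w.reverse μ.transpose := by
  have key : ∀ p : ℕ × ℕ → Prop, ∀ [DecidablePred p], (μ.transpose.cells.filter p).card =
      (μ.cells.filter fun c => p c.swap).card := by
    intro p _
    apply Finset.card_bij (fun c _ => c.swap)
    · intro c hc
      simp only [Finset.mem_filter, YoungDiagram.mem_cells, YoungDiagram.mem_transpose] at hc ⊢
      simpa using hc
    · intro c _ d _ h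
      exact Prod.swap_injective h
    · intro c hc
      simp only [Finset.mem_filter, YoungDiagram.mem_cells] at hc
      exact ⟨c.swap, by simpa using hc, by simp⟩
  refine ⟨fun k => ?_, fun k => ?_⟩
  · rw [h.2, key]
    rfl
  · rw [List.reverse_reverse, h.1, key]
    rfl

theorem HasShape.congr {u v : List α} {μ : YoungDiagram} (h : HasShape u μ) (hu : u.Nodup)
    (e : KnuthEquiv u v) : HasShape v μ :=
  ⟨fun k => (e.greene_eq hu k).symm.trans (h.1 k),
    fun k => (e.reverse.greene_eq (List.nodup_reverse.2 hu) k).symm.trans (h.2 k)⟩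

theorem FitsBelow.length_le {R S : List α} (h : FitsBelow R S) : S.length ≤ R.length := by
  by_contra hlt
  obtain ⟨h', -⟩ := h.getElem R.length (by omega)
  exact lt_irrefl _ h'

theorem IsTab.length_succ_le {T : List (List α)} (hT : IsTab T) (i : ℕ) :
    (T.getD (i + 1) []).length ≤ (T.getD i []).length := by
  induction T generalizing i with
  | nil => simp
  | cons R T ih => cases i with
    | zero => cases T with
      | nil => simp
      | cons S T => simpa using hT.2.1.length_le
    | succ i => simpa using ih hT.2.2 i

/-- The Young diagram formed by the rows of a tableau. -/
def tabShape (T : List (List α)) (hT : IsTab T) : YoungDiagram where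
  cells := (Finset.range T.length).biUnion fun i =>
    (Finset.range (T.getD i []).length).image fun j => (i, j)
  isLowerSet := by
    have mem : ∀ c : ℕ × ℕ, c ∈ ((Finset.range T.length).biUnion fun i =>
        (Finset.range (T.getD i []).length).image fun j => (i, j)) ↔
        c.2 < (T.getD c.1 []).length := by
      rintro ⟨i, j⟩
      simp only [Finset.mem_biUnion, Finset.mem_range, Finset.mem_image, Prod.mk.injEq]
      constructor
      · rintro ⟨i, -, j, hj, rfl, rfl⟩
        exact hj
      · intro h
        refine ⟨i, ?_, j, h, rfl, rfl⟩
        by_contra hi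
        rw [List.getD_eq_default _ _ (by omega)] at h
        simp at h
    rintro c d h hc
    rw [Finset.mem_coe, mem] at hc ⊢
    exact (h.2.trans_lt hc).trans_le
      (antitone_nat_of_succ_le (f := fun i => (T.getD i []).length) hT.length_succ_le h.1)

theorem mem_tabShape {T : List (List α)} {hT : IsTab T} {c : ℕ × ℕ} :
    c ∈ tabShape T hT ↔ c.2 < (T.getD c.1 []).length := by
  obtain ⟨i, j⟩ := c
  rw [← YoungDiagram.mem_cells]
  simp only [tabShape, Finset.mem_biUnion, Finset.mem_range, Finset.mem_image, Prod.mk.injEq]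
  constructor
  · rintro ⟨i, -, j, hj, rfl, rfl⟩
    exact hj
  · intro h
    refine ⟨i, ?_, j, h, rfl, rfl⟩
    by_contra hi
    rw [List.getD_eq_default _ _ (by omega)] at h
    simp at h

/-- The cell of a letter of a tableau. -/
def tabPos : List (List α) → α → ℕ × ℕ
  | [], _ => 0
  | R :: T, x => if x ∈ R then (0, R.idxOf x) else ((tabPos T x).1 + 1, (tabPos T x).2)

theorem getD_tabPos {T : List (List α)} {x : α} (hx : x ∈ tabWord T) :
    (T.getD (tabPos T x).1 [])[(tabPos T x).2]? = some x := by
  induction T with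
  | nil => simp [tabWord] at hx
  | cons R T ih =>
    by_cases h : x ∈ R
    · simp [tabPos, h]
    · simp only [tabWord, List.mem_append, h, or_false] at hx
      simpa [tabPos, h] using ih hx

theorem exists_tabPos {T : List (List α)} (hn : (tabWord T).Nodup) {i j : ℕ}
    (h : j < (T.getD i []).length) : ∃ x ∈ tabWord T, tabPos T x = (i, j) := by
  induction T generalizing i with
  | nil => simp at h
  | cons R T ih =>
    rw [tabWord, List.nodup_append] at hn
    cases i with
    | zero =>
      have h : j < R.length := by simpa using h
      refine ⟨R[j], by simp [tabWord], ?_⟩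
      simp [tabPos, hn.2.1.idxOf_getElem]
    | succ i =>
      obtain ⟨x, hx, e⟩ := ih hn.1 (i := i) (by simpa using h)
      have : x ∉ R := fun h => hn.2.2 x hx x h rfl
      exact ⟨x, by simp [tabWord, hx], by simp [tabPos, this, e]⟩

theorem exists_head_lt {R : List α} {T : List (List α)} (hT : IsTab (R :: T)) {x : α}
    (hx : x ∈ tabWord T) : ∃ h : (tabPos T x).2 < R.length, R[(tabPos T x).2] < x := by
  induction T generalizing R with
  | nil => simp [tabWord] at hx
  | cons S T ih =>
    have hf : FitsBelow R S := hT.2.1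
    by_cases h : x ∈ S
    · obtain ⟨h1, h2⟩ := hf.getElem (S.idxOf x) (List.idxOf_lt_length_of_mem h)
      simp only [tabPos, h, if_true]
      exact ⟨h1, by simpa using h2⟩
    · simp only [tabWord, List.mem_append, h, or_false] at hx
      obtain ⟨h1, h2⟩ := ih hT.2.2 hx
      obtain ⟨h3, h4⟩ := hf.getElem _ h1
      simp only [tabPos, h, if_false]
      exact ⟨h3, h4.trans h2⟩

/-- Lower rows are read first, so rows of the tableau are increasing and columns decreasing
subsequences of the reading word. -/
theorem IsTab.hasShape {T : List (List α)} (hT : IsTab T) (hn : (tabWord T).Nodup) :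
    HasShape (tabWord T) (tabShape T hT) := by
  apply HasShape.of_bijOn hn (pos := tabPos T)
  · refine ⟨?_, ?_, ?_⟩
    · intro x hx
      rw [Finset.mem_coe, YoungDiagram.mem_cells, mem_tabShape]
      exact (List.getElem?_eq_some_iff.1 (getD_tabPos hx)).1
    · intro x hx y hy h
      have := getD_tabPos hx
      rw [h, getD_tabPos hy] at this
      exact (Option.some.inj this).symm
    · rintro ⟨i, j⟩ hc
      rw [Finset.mem_coe, YoungDiagram.mem_cells, mem_tabShape] at hc
      obtain ⟨x, hx, e⟩ := exists_tabPos hn hc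
      exact ⟨x, hx, e⟩
  · induction T with
    | nil => simp [tabWord]
    | cons R T ih =>
      rw [tabWord, List.nodup_append] at hn
      rw [tabWord, List.pairwise_append]
      refine ⟨(ih hT.2.2 hn.1).imp_of_mem ?_, hT.1.imp ?_, ?_⟩
      · intro x y hx hy h e
        have h1 : x ∉ R := fun h => hn.2.2 x hx x h rfl
        have h2 : y ∉ R := fun h => hn.2.2 y hy y h rfl
        exact h (by simpa [tabPos, h1, h2] using e)
      · exact fun h _ => h
      · intro x hx y hy e
        have h1 : x ∉ R := fun h => hn.2.2 x hx x h rfl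
        simp [tabPos, h1, hy] at e
  · induction T with
    | nil => simp [tabWord]
    | cons R T ih =>
      rw [tabWord, List.nodup_append] at hn
      rw [tabWord, List.pairwise_append]
      refine ⟨(ih hT.2.2 hn.1).imp_of_mem ?_, hT.1.imp_of_mem ?_, ?_⟩
      · intro x y hx hy h e
        have h1 : x ∉ R := fun h => hn.2.2 x hx x h rfl
        have h2 : y ∉ R := fun h => hn.2.2 y hy y h rfl
        exact h (by simpa [tabPos, h1, h2] using e)
      · intro x y hx hy h e
        simp only [tabPos, hx, hy, if_true] at e
        exact absurd (List.idxOf_inj hx |>.1 e) h.ne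
      · intro x hx y hy e
        have h1 : x ∉ R := fun h => hn.2.2 x hx x h rfl
        simp only [tabPos, hy, h1, if_true, if_false] at e
        obtain ⟨h2, h3⟩ := exists_head_lt hT hx
        simp only [e] at h3
        simpa using h3

end Words
-- Adding one box to a Young diagram
/-- `ν` arises from `μ` by adding the cell `c`. -/
def AddBox (μ : YoungDiagram) (c : ℕ × ℕ) (ν : YoungDiagram) : Prop :=
  c ∉ μ.cells ∧ ν.cells = insert c μ.cells

namespace AddBox

variable {μ ν κ : YoungDiagram} {c d : ℕ × ℕ}

theorem cell_unique (h : AddBox μ c ν) (h' : AddBox μ d ν) : c = d := by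
  have : c ∈ insert d μ.cells := by
    rw [← h'.2, h.2]
    simp
  rw [Finset.mem_insert] at this
  exact this.resolve_right h.1

theorem right_unique (h : AddBox μ c ν) (h' : AddBox μ c κ) : ν = κ :=
  YoungDiagram.ext (h.2.trans h'.2.symm)

theorem card (h : AddBox μ c ν) : ν.card = μ.card + 1 := by
  rw [YoungDiagram.card, h.2, Finset.card_insert_of_notMem h.1]

theorem le (h : AddBox μ c ν) : μ ≤ ν := by
  rw [← YoungDiagram.cells_subset_iff, h.2]
  exact Finset.subset_insert _ _

theorem transpose (h : AddBox μ c ν) : AddBox μ.transpose c.swap ν.transpose := by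
  refine ⟨by simpa using h.1, ?_⟩
  ext d
  have : d.swap ∈ ν.cells ↔ d.swap ∈ insert c μ.cells := by rw [h.2]
  simp only [YoungDiagram.mem_cells, YoungDiagram.mem_transpose, Finset.mem_insert] at this ⊢
  rw [this]
  constructor
  · rintro (h | h)
    · left; rw [← h]; simp
    · exact Or.inr h
  · rintro (h | h)
    · left; rw [h]; simp
    · exact Or.inr h

theorem of_rowLen {r : ℕ} (h : ∀ i, ν.rowLen i = μ.rowLen i + if i = r then 1 else 0) :
    AddBox μ (r, μ.rowLen r) ν := by
  refine ⟨by simp [YoungDiagram.mem_iff_lt_rowLen], ?_⟩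
  ext ⟨i, j⟩
  simp only [Finset.mem_insert, YoungDiagram.mem_cells, YoungDiagram.mem_iff_lt_rowLen, h,
    Prod.mk.injEq]
  split_ifs with e
  · subst e
    simp only [true_and]
    omega
  · simp [e]

theorem exists_of_le (h : μ ≤ ν) (hc : ν.card = μ.card + 1) : ∃ c, AddBox μ c ν := by
  rw [← YoungDiagram.cells_subset_iff] at h
  have : (ν.cells \ μ.cells).card = 1 := by
    rw [Finset.card_sdiff_of_subset h]
    unfold YoungDiagram.card at hc
    omega
  obtain ⟨c, e⟩ := Finset.card_eq_one.1 this
  have hm : c ∈ ν.cells \ μ.cells := by simp [e]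
  refine ⟨c, (Finset.mem_sdiff.1 hm).2, ?_⟩
  rw [Finset.insert_eq, ← e, Finset.sdiff_union_of_subset h]

end AddBox

/-! ### Shapes of words: adding a letter, deleting the largest letter -/

section Words

variable {α : Type*} [LinearOrder α]

/-- `AddMax T m U r`: the list of rows `U` arises from `T` by appending `m` to row `r`. -/
inductive AddMax : List (List α) → α → List (List α) → ℕ → Prop
  | nil (m : α) : AddMax [] m [[m]] 0
  | head (R : List α) (T : List (List α)) (m : α) : AddMax (R :: T) m ((R ++ [m]) :: T) 0
  | tail (R : List α) {T U : List (List α)} {m : α} {r : ℕ} :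
      AddMax T m U r → AddMax (R :: T) m (R :: U) (r + 1)

theorem AddMax.length_getD {β : Type*} {T U : List (List β)} {m : β} {r : ℕ} (h : AddMax T m U r)
    (i : ℕ) : (U.getD i []).length = (T.getD i []).length + if i = r then 1 else 0 := by
  induction h generalizing i with
  | nil => cases i <;> simp
  | head => cases i <;> simp
  | tail R h ih => cases i with
    | zero => simp
    | succ i => simpa using ih i

theorem rowLen_tabShape {T : List (List α)} (hT : IsTab T) (i : ℕ) :
    (tabShape T hT).rowLen i = (T.getD i []).length := by
  have h : ∀ j, j < (tabShape T hT).rowLen i ↔ j < (T.getD i []).length := fun j => by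
    rw [← YoungDiagram.mem_iff_lt_rowLen, mem_tabShape]
  have h1 := h ((tabShape T hT).rowLen i)
  have h2 := h (T.getD i []).length
  omega

/-- The largest letter ends its row and has nothing below it, so deleting it leaves a tableau. -/
theorem exists_addMax {U : List (List α)} (hU : IsTab U) (hn : (tabWord U).Nodup) {m : α}
    (hm : m ∈ tabWord U) (hmax : ∀ a ∈ tabWord U, a ≤ m) :
    ∃ T r, IsTab T ∧ AddMax T m U r ∧ tabWord T = (tabWord U).filter (· < m) := by
  induction U with
  | nil => simp [tabWord] at hm
  | cons R U ih =>
    rw [tabWord, List.nodup_append] at hn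
    simp only [tabWord, List.mem_append] at hm hmax
    by_cases hR : m ∈ R
    · obtain ⟨l, s, rfl⟩ := List.append_of_mem hR
      have hp := hU.1
      rw [List.pairwise_append, List.pairwise_cons] at hp
      have hs : s = [] := List.eq_nil_iff_forall_not_mem.2 fun a ha =>
        (hmax a (by simp [ha])).not_gt (hp.2.1.1 a ha)
      subst hs
      have hlt : ∀ a ∈ tabWord U, a < m := fun a ha =>
        lt_of_le_of_ne (hmax a (Or.inl ha)) (hn.2.2 a ha m (by simp))
      refine ⟨l :: U, 0, ⟨hp.1, ?_, hU.2.2⟩, AddMax.head l U m, ?_⟩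
      · refine hU.2.1.of_append_max fun a ha => hlt a ?_
        cases U with
        | nil => simp at ha
        | cons S U =>
          have ha : a ∈ S := ha
          simp [tabWord, ha]
      · simp only [tabWord, List.filter_append]
        rw [List.filter_eq_self.2 (by simpa using hlt),
          List.filter_eq_self.2 (by simpa using fun a ha => hp.2.2 a ha m (by simp))]
        simp
    · obtain ⟨T, r, hT, h, e⟩ := ih hU.2.2 hn.1 (hm.resolve_right hR)
        (fun a ha => hmax a (Or.inl ha))
      refine ⟨R :: T, r + 1, ⟨hU.1, ?_, hT⟩, h.tail R, ?_⟩
      · have := hU.2.1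
        cases h with
        | nil => simp
        | head S T m => exact FitsBelow.of_append this
        | tail S h => exact this
      · simp only [tabWord, List.filter_append]
        rw [e, List.filter_eq_self (l := R) |>.2]
        intro a ha
        simpa using lt_of_le_of_ne (hmax a (Or.inr ha)) fun h => hR (h ▸ ha)

/-- The bumping path is unchanged down to row `r`. There the letter that was appended now meets `m`
and bumps it, and `m`, being maximal, goes to the end of the next row. -/
theorem RowInsert.addMax {T W U : List (List α)} {x m : α} {r : ℕ} (h : RowInsert T x W r)
    (hU : AddMax T m U r) (hT : ∀ a ∈ tabWord T, a < m) (hx : x < m) :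
    ∃ W', RowInsert U x W' (r + 1) := by
  induction h generalizing U with
  | nil x =>
    cases hU
    exact ⟨_, RowInsert.bump (l := []) [] (by simp) hx (RowInsert.nil m)⟩
  | @last R T x h =>
    cases hU
    have : ∃ W', RowInsert T m W' 0 := by
      cases T with
      | nil => exact ⟨_, RowInsert.nil m⟩
      | cons S T => exact ⟨_, RowInsert.last T fun a ha => hT a (by simp [tabWord, ha])⟩
    obtain ⟨W', hW⟩ := this
    exact ⟨_, RowInsert.bump [] h hx hW⟩
  | bump s h1 h2 h ih =>
    cases hU with
    | tail _ hU =>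
      obtain ⟨W', hW⟩ := ih hU (fun a ha => hT a (by simp [tabWord, ha])) (hT _ (by simp [tabWord]))
      exact ⟨_, RowInsert.bump s h1 h2 hW⟩

open Classical in
/-- The shape of a word without repeated letters. -/
noncomputable def wordShape (w : List α) : YoungDiagram :=
  if h : ∃ μ, HasShape w μ then h.choose else ⊥

theorem HasShape.wordShape_eq {w : List α} {μ : YoungDiagram} (h : HasShape w μ) :
    wordShape w = μ := by
  have h' : ∃ μ, HasShape w μ := ⟨μ, h⟩
  rw [wordShape, dif_pos h']
  exact h'.choose_spec.unique h

theorem hasShape_wordShape {w : List α} (hw : w.Nodup) : HasShape w (wordShape w) := by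
  obtain ⟨T, hT, h⟩ := exists_tab w hw
  have := (hT.hasShape (h.perm.nodup_iff.1 hw)).congr (h.perm.nodup_iff.1 hw) h.symm
  rwa [this.wordShape_eq]

theorem wordShape_reverse {w : List α} (hw : w.Nodup) :
    wordShape w.reverse = (wordShape w).transpose :=
  (hasShape_wordShape hw).reverse.wordShape_eq

theorem KnuthEquiv.wordShape_eq {u v : List α} (h : KnuthEquiv u v) (hu : u.Nodup) :
    wordShape u = wordShape v :=
  ((hasShape_wordShape hu).congr hu h).wordShape_eq.symm

theorem KnuthEquiv.wordShape_eq_tabShape {u : List α} {T : List (List α)}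
    (h : KnuthEquiv u (tabWord T)) (hu : u.Nodup) (hT : IsTab T) :
    wordShape u = tabShape T hT := by
  rw [h.wordShape_eq hu]
  exact (hT.hasShape (h.perm.nodup_iff.1 hu)).wordShape_eq

theorem nodup_of_append_singleton {β : Type*} {w : List β} {x : β} (hw : (w ++ [x]).Nodup) :
    w.Nodup ∧ x ∉ w := by
  rw [List.nodup_append] at hw
  exact ⟨hw.1, fun h => hw.2.2 x h x (by simp) rfl⟩

theorem wordShape_append {w : List α} {x : α} (hw : (w ++ [x]).Nodup) :
    ∃ c, AddBox (wordShape w) c (wordShape (w ++ [x])) ∧ ((∀ a ∈ w, a < x) → c.1 = 0) := by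
  obtain ⟨h1, h2⟩ := nodup_of_append_singleton hw
  obtain ⟨T, hT, h⟩ := exists_tab w h1
  obtain ⟨T', r, hi⟩ := RowInsert.exists hT (x := x) (fun hx => h2 (h.perm.mem_iff.2 hx))
    (h.perm.nodup_iff.1 h1)
  rw [h.wordShape_eq_tabShape h1 hT,
    ((h.append_right _).trans (hi.knuthEquiv hT)).wordShape_eq_tabShape hw (hi.isTab hT)]
  refine ⟨_, AddBox.of_rowLen (r := r) fun i => ?_, fun hx => ?_⟩
  · rw [rowLen_tabShape, rowLen_tabShape, hi.length_getD]
  · cases hi with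
    | nil => rfl
    | last => rfl
    | @bump T _ l _ y s r _ h4 _ =>
      exact absurd h4 (hx y (h.perm.mem_iff.2 (by simp [tabWord]))).asymm

/-- Prepending is appending to the reversed word, whose shape is the transpose; thus row 0 becomes
column 0. -/
theorem wordShape_cons {w : List α} {x : α} (hw : (x :: w).Nodup) :
    ∃ c, AddBox (wordShape w) c (wordShape (x :: w)) ∧ ((∀ a ∈ w, a < x) → c.2 = 0) := by
  have hw' : (w.reverse ++ [x]).Nodup := by simpa using List.nodup_reverse.2 hw
  obtain ⟨c, h1, h2⟩ := wordShape_append hw'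
  have h3 := h1.transpose
  rw [← List.reverse_cons, wordShape_reverse hw, wordShape_reverse hw.of_cons,
    YoungDiagram.transpose_transpose, YoungDiagram.transpose_transpose] at h3
  exact ⟨c.swap, h3, fun h => h2 (by simpa using h)⟩

theorem wordShape_filter {w : List α} (hw : w.Nodup) {m : α} (hm : m ∈ w)
    (hmax : ∀ a ∈ w, a ≤ m) :
    ∃ c, AddBox (wordShape (w.filter (· < m))) c (wordShape w) := by
  obtain ⟨U, hU, h⟩ := exists_tab w hw
  obtain ⟨T, r, hT, ha, e⟩ := exists_addMax hU (h.perm.nodup_iff.1 hw) (h.perm.mem_iff.1 hm)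
    fun a ha => hmax a (h.perm.mem_iff.2 ha)
  rw [h.wordShape_eq_tabShape hw hU,
    (e ▸ h.filter_lt m : KnuthEquiv _ (tabWord T)).wordShape_eq_tabShape (hw.filter _) hT]
  refine ⟨_, AddBox.of_rowLen (r := r) fun i => ?_⟩
  rw [rowLen_tabShape, rowLen_tabShape, ha.length_getD]

/-- Both `m` and `x` claim the cell `c` of the word without `m`; `RowInsert.addMax` then sends the
new box one row down. The column is left open, since only the row is used. -/
theorem wordShape_append_of_max {w : List α} {x m : α} (hw : (w ++ [x]).Nodup) (hm : m ∈ w)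
    (hmax : ∀ a ∈ w ++ [x], a ≤ m) {c : ℕ × ℕ}
    (h1 : AddBox (wordShape (w.filter (· < m))) c (wordShape w))
    (h2 : AddBox (wordShape (w.filter (· < m))) c (wordShape (w.filter (· < m) ++ [x]))) :
    ∃ c', AddBox (wordShape w) c' (wordShape (w ++ [x])) ∧ c'.1 = c.1 + 1 := by
  obtain ⟨hn, hx⟩ := nodup_of_append_singleton hw
  have hxm : x < m := lt_of_le_of_ne (hmax x (by simp)) fun h => hx (h ▸ hm)
  obtain ⟨U, hU, h⟩ := exists_tab w hn
  have hUn := h.perm.nodup_iff.1 hn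
  obtain ⟨T, r, hT, ha, e⟩ := exists_addMax hU hUn (h.perm.mem_iff.1 hm)
    fun a ha => hmax a (by simp [h.perm.mem_iff.2 ha])
  have hf : KnuthEquiv (w.filter (· < m)) (tabWord T) := e ▸ h.filter_lt m
  have hfx : (w.filter (· < m) ++ [x]).Nodup := by
    have := hw.filter (· < m)
    simpa [hxm] using this
  have hTn := hf.perm.nodup_iff.1 (hn.filter _)
  obtain ⟨W, s, hi⟩ := RowInsert.exists hT (x := x)
    (fun h => (nodup_of_append_singleton hfx).2 (hf.perm.mem_iff.2 h)) hTn
  rw [hf.wordShape_eq_tabShape (hn.filter _) hT] at h1 h2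
  rw [h.wordShape_eq_tabShape hn hU] at h1 ⊢
  rw [((hf.append_right _).trans (hi.knuthEquiv hT)).wordShape_eq_tabShape hfx
    (hi.isTab hT)] at h2
  have h3 : AddBox (tabShape T hT) (r, (tabShape T hT).rowLen r) (tabShape U hU) :=
    AddBox.of_rowLen fun i => by rw [rowLen_tabShape, rowLen_tabShape, ha.length_getD]
  have h4 : AddBox (tabShape T hT) (s, (tabShape T hT).rowLen s) (tabShape W (hi.isTab hT)) :=
    AddBox.of_rowLen fun i => by rw [rowLen_tabShape, rowLen_tabShape, hi.length_getD]
  have e1 := h1.cell_unique h3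
  have e2 := h2.cell_unique h4
  have hrs : s = r := by
    rw [e1, Prod.mk.injEq] at e2
    exact e2.1.symm
  subst hrs
  obtain ⟨W', hi'⟩ := hi.addMax ha (fun a ha => by
    rw [e] at ha
    simpa using (List.mem_filter.1 ha).2) hxm
  rw [((h.append_right _).trans (hi'.knuthEquiv hU)).wordShape_eq_tabShape hw (hi'.isTab hU)]
  refine ⟨_, AddBox.of_rowLen (r := s + 1) fun i => ?_, by rw [e1]⟩
  rw [rowLen_tabShape, rowLen_tabShape, hi'.length_getD]

theorem wordShape_cons_of_max {w : List α} {x m : α} (hw : (x :: w).Nodup) (hm : m ∈ w)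
    (hmax : ∀ a ∈ x :: w, a ≤ m) {c : ℕ × ℕ}
    (h1 : AddBox (wordShape (w.filter (· < m))) c (wordShape w))
    (h2 : AddBox (wordShape (w.filter (· < m))) c (wordShape (x :: w.filter (· < m)))) :
    ∃ c', AddBox (wordShape w) c' (wordShape (x :: w)) ∧ c'.2 = c.2 + 1 := by
  have hw' : (w.reverse ++ [x]).Nodup := by simpa using List.nodup_reverse.2 hw
  have hfx : (x :: w.filter (· < m)).Nodup := by
    rw [List.nodup_cons] at hw ⊢
    exact ⟨fun h => hw.1 (List.mem_filter.1 h).1, hw.2.filter _⟩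
  obtain ⟨c', h3, h4⟩ := wordShape_append_of_max (c := c.swap) hw' (by simpa using hm)
    (fun a ha => hmax a (by simpa [or_comm] using ha))
    (by
      rw [List.filter_reverse, wordShape_reverse (hw.of_cons.filter _),
        wordShape_reverse hw.of_cons]
      exact h1.transpose)
    (by
      rw [List.filter_reverse, ← List.reverse_cons, wordShape_reverse (hw.of_cons.filter _),
        wordShape_reverse hfx]
      exact h2.transpose)
  have h5 := h3.transpose
  rw [← List.reverse_cons, wordShape_reverse hw, wordShape_reverse hw.of_cons,
    YoungDiagram.transpose_transpose, YoungDiagram.transpose_transpose] at h5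
  exact ⟨c'.swap, h5, by simpa using h4⟩

end Words

/-! ### Pairs of shapes that differ by two boxes -/

namespace AddBox

variable {μ ν ν' κ ξ : YoungDiagram} {a b a' b' c : ℕ × ℕ}

theorem mem_iff (h : AddBox μ a ν) {d : ℕ × ℕ} : d ∈ ν ↔ d = a ∨ d ∈ μ := by
  rw [← YoungDiagram.mem_cells, h.2, Finset.mem_insert, YoungDiagram.mem_cells]

theorem notMem (h : AddBox μ a ν) : a ∉ μ := h.1

theorem two (h : AddBox μ a ν) (h1 : AddBox ν b κ) (h' : AddBox μ a' ν') (h1' : AddBox ν' b' κ) :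
    (a = a' ∧ b = b') ∨ (a = b' ∧ b = a') := by
  have m1 := h.notMem
  have m2 := h1.notMem
  have m3 := h'.notMem
  have m4 := h1'.notMem
  rw [h.mem_iff] at m2
  rw [h'.mem_iff] at m4
  have key : ∀ d, (d = b ∨ d = a ∨ d ∈ μ) ↔ (d = b' ∨ d = a' ∨ d ∈ μ) := fun d => by
    rw [← h.mem_iff, ← h1.mem_iff, h1'.mem_iff, h'.mem_iff]
  have k1 := key a
  have k2 := key b
  have k3 := key a'
  have k4 := key b'
  grind

/-- The cell directly below `a` would have to be present before the diagonal neighbour of `a` is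
added. -/
theorem not_diagonal (h : AddBox μ a ν) (h1 : AddBox ν b κ) :
    ¬ (b.1 = a.1 + 1 ∧ b.2 = a.2 + 1) := by
  rintro ⟨e1, e2⟩
  have hb : (b.1, b.2) ∈ κ := h1.mem_iff.2 (Or.inl rfl)
  have h2 : (a.1 + 1, a.2) ∈ κ := κ.up_left_mem (by omega) (by omega) hb
  rw [h1.mem_iff, h.mem_iff] at h2
  rcases h2 with h2 | h2 | h2
  · rw [← h2] at e2
    simp at e2
  · have := congrArg Prod.fst h2
    simp at this
  · exact h.notMem (μ.up_left_mem (i1 := a.1) (j1 := a.2) (by omega) le_rfl h2)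

theorem lt (h : AddBox μ a ν) : μ < ν := by
  refine lt_of_le_of_ne h.le fun e => ?_
  have := h.card
  rw [e] at this
  omega

theorem between (h : AddBox μ a ν) (h1 : AddBox ν b κ) (h2 : μ < ξ) (h3 : ξ < κ) :
    ∃ d, AddBox μ d ξ ∧ (d = a ∨ d = b) := by
  have c1 := Finset.card_lt_card (YoungDiagram.cells_ssubset_iff.2 h2)
  have c2 := Finset.card_lt_card (YoungDiagram.cells_ssubset_iff.2 h3)
  have c3 := h.card
  have c4 := h1.card
  unfold YoungDiagram.card at c3 c4
  obtain ⟨d, hd⟩ := exists_of_le h2.le (by unfold YoungDiagram.card; omega)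
  have hm : d ∈ κ := YoungDiagram.cells_subset_iff.2 h3.le (hd.mem_iff.2 (Or.inl rfl))
  rw [h1.mem_iff, h.mem_iff] at hm
  refine ⟨d, hd, ?_⟩
  rcases hm with hm | hm | hm
  · exact Or.inr hm
  · exact Or.inl hm
  · exact absurd hm hd.notMem

/-- Cells in one row or column are comparable, so their order of insertion is forced. -/
theorem between_of_aligned (h : AddBox μ a ν) (h1 : AddBox ν b κ) (hab : b.1 = a.1 ∨ b.2 = a.2)
    (h2 : μ < ξ) (h3 : ξ < κ) : ξ = ν := by
  obtain ⟨d, hd, rfl | rfl⟩ := h.between h1 h2 h3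
  · exact hd.right_unique h
  · exfalso
    have ha : (a.1, a.2) ∈ ν := h.mem_iff.2 (Or.inl rfl)
    have hdd : (d.1, d.2) ∈ ξ := hd.mem_iff.2 (Or.inl rfl)
    have k1 : ¬ (d.1 ≤ a.1 ∧ d.2 ≤ a.2) := fun h => h1.notMem (ν.up_left_mem h.1 h.2 ha)
    have k2 : ¬ (a.1 ≤ d.1 ∧ a.2 ≤ d.2) := fun hh => by
      have : a ∈ ξ := ξ.up_left_mem hh.1 hh.2 hdd
      rw [hd.mem_iff] at this
      rcases this with rfl | this
      · exact h1.notMem ha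
      · exact h.notMem this
    omega

end AddBox

/-! ### The local rule for words -/

section Words

variable {α : Type*} [LinearOrder α]

/-- The degenerate case of the local rule: with both boxes in one row or column,
`AddBox.between_of_aligned` excludes a second intermediate shape. Proved by removing the largest
letter. -/
theorem aligned_of_cons_eq_append {p q : α} {w : List α} (hw : (p :: w ++ [q]).Nodup) {c : ℕ × ℕ}
    (h1 : AddBox (wordShape w) c (wordShape (p :: w)))
    (h2 : AddBox (wordShape w) c (wordShape (w ++ [q]))) :
    ∃ c', AddBox (wordShape (p :: w)) c' (wordShape (p :: w ++ [q])) ∧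
      (c'.1 = c.1 ∨ c'.2 = c.2) := by
  induction hl : w.length using Nat.strong_induction_on generalizing w c with
  | _ N ih =>
  have hpw : (p :: w).Nodup := (nodup_of_append_singleton hw).1
  have hwq : (w ++ [q]).Nodup := List.Nodup.of_cons hw
  have heq := h1.right_unique h2
  obtain ⟨m, hm, hmax⟩ := Finset.exists_max_image (p :: w ++ [q]).toFinset id ⟨p, by simp⟩
  simp only [List.mem_toFinset, id] at hm hmax
  have hlt : ∀ a ∈ p :: w ++ [q], a ≠ m → a < m := fun a ha h => lt_of_le_of_ne (hmax a ha) h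
  have hp1 : p ∉ w ++ [q] := (List.nodup_cons.1 hw).1
  have hq1 : q ∉ p :: w := (nodup_of_append_singleton hw).2
  rw [List.cons_append, List.mem_cons, List.mem_append, List.mem_singleton] at hm
  rcases hm with rfl | hm | rfl
  -- A prepended maximum always adds a box in column 0, both before and after `q` is appended.
  · obtain ⟨c1, k1, k2⟩ := wordShape_cons hw
    obtain ⟨c2, k3, k4⟩ := wordShape_cons hpw
    have hlt' : ∀ a ∈ w ++ [q], a < m := fun a ha =>
      hlt a (by simpa using Or.inr (by simpa using ha)) fun h => hp1 (h ▸ ha)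
    have := h1.cell_unique k3
    refine ⟨c1, heq ▸ k1, Or.inr ?_⟩
    rw [k2 hlt', this, k4 fun a ha => hlt' a (by simp [ha])]
  · have hp : p < m := hlt p (by simp) fun h => hp1 (by simp [h, hm])
    have hq : q < m := hlt q (by simp) fun h => hq1 (by simp [h, hm])
    have hmw : ∀ a ∈ w, a ≤ m := fun a ha => hmax a (by simp [ha])
    have hw0 : w.Nodup := hpw.of_cons
    set v := w.filter (· < m) with hv
    have f1 : (p :: w).filter (· < m) = p :: v := by simp [hp, hv]
    have f2 : (w ++ [q]).filter (· < m) = v ++ [q] := by simp [hq, hv]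
    have f3 : (p :: w ++ [q]).filter (· < m) = p :: v ++ [q] := by simp [hp, hq, hv]
    have hn3 : (p :: v ++ [q]).Nodup := f3 ▸ hw.filter _
    have hn1 : (p :: v).Nodup := f1 ▸ hpw.filter _
    have hn2 : (v ++ [q]).Nodup := f2 ▸ hwq.filter _
    -- The edges of the cube of shapes over `v`: `A`, `A'` add `p`; `B`, `B'` add `q`; `M`, `M1`,
    -- `M2`, `M3` add `m`. At the top, `C` adds `q` to `p :: w`, and also `p` to `w ++ [q]`, as
    -- these two have equal shape.
    obtain ⟨M, hM⟩ := wordShape_filter hw0 hm hmw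
    obtain ⟨A, hA, -⟩ := wordShape_cons hn1
    obtain ⟨B, hB, -⟩ := wordShape_append hn2
    obtain ⟨A', hA', -⟩ := wordShape_cons (show (p :: (v ++ [q])).Nodup from hn3)
    obtain ⟨B', hB', -⟩ := wordShape_append hn3
    obtain ⟨M1, hM1⟩ := wordShape_filter hpw (m := m) (by simp [hm])
      fun a ha => hmax a (by simp [List.mem_cons.1 ha |>.imp_right Or.inl])
    obtain ⟨M2, hM2⟩ := wordShape_filter hwq (m := m) (by simp [hm])
      fun a ha => hmax a (by simpa using Or.inr (by simpa using ha))
    obtain ⟨M3, hM3⟩ := wordShape_filter hw (m := m) (by simp [hm]) hmax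
    obtain ⟨C, hC, -⟩ := wordShape_append hw
    have C' : AddBox (wordShape (w ++ [q])) C (wordShape (p :: (w ++ [q]))) := by
      rw [← heq]
      exact hC
    have TR := wordShape_append_of_max (c := M) hwq hm
      (fun a ha => hmax a (by simpa using Or.inr (by simpa using ha))) hM
    have TL := wordShape_cons_of_max (c := M) hpw hm
      (fun a ha => hmax a (by simp [List.mem_cons.1 ha |>.imp_right Or.inl])) hM
    have TR' := fun c => wordShape_append_of_max (c := c) hw (m := m) (by simp [hm]) hmax
    have TL' := fun c => wordShape_cons_of_max (c := c)
      (show (p :: (w ++ [q])).Nodup from hw) (m := m) (by simp [hm]) hmax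
    rw [f1] at hM1
    rw [f2] at hM2
    rw [f3] at hM3
    simp only [f1] at TR'
    simp only [f2] at TL'
    rw [← hv] at TR TL hM
    refine ⟨C, hC, ?_⟩
    have t1 := hA.two hM1 hM h1
    have t2 := hB.two hM2 hM h2
    have t3 := hA.two hB' hB hA'
    have t4 := hB'.two hM3 hM1 hC
    by_cases hAB : A = B
    · have hA'B' : A' = B' := by grind
      by_cases hMA : M = A
      -- All three letters claim one cell, so `c` would be one row below and one column to the right
      -- of `M`, which is impossible.
      · obtain ⟨d, hd, e⟩ := TR (hMA ▸ hAB ▸ hB)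
        obtain ⟨d', hd', e'⟩ := TL (hMA ▸ hA)
        rw [← h2.cell_unique hd] at e
        rw [← h1.cell_unique hd'] at e'
        exact absurd ⟨e, e'⟩ (hM.not_diagonal h1)
      · have hM1M : M1 = M := by grind
        have hM2M : M2 = M := by grind
        have hcA : c = A := by grind
        -- Here `m` is independent of `p` and `q`: the induction hypothesis aligns `B'` with `A =
        -- c`. Then `C = B'`, since `M1 = B'` would force the forbidden diagonal position again.
        obtain ⟨B'', hB'', hadj⟩ := ih v.length (by
          rw [← hl, hv]
          exact List.length_filter_lt_length_iff_exists.2 ⟨m, hm, by simp⟩) hn3 hA (hAB ▸ hB) rfl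
        rw [hB''.cell_unique hB'] at hadj
        rcases t4 with ⟨e1, -⟩ | ⟨e1, -⟩
        · obtain ⟨d, hd, e⟩ := TR' M1 hM1 (e1 ▸ hB')
          obtain ⟨d', hd', e'⟩ := TL' M1 (hM1M ▸ hM2M ▸ hM2) (e1 ▸ hA'B' ▸ hA')
          rw [← hC.cell_unique hd] at e
          rw [← C'.cell_unique hd'] at e'
          exact absurd ⟨e, e'⟩ (hM1.not_diagonal hC)
        · rwa [← e1, hcA]
    · have t5 := hA.two hM1 hB (heq ▸ hM2)
      have hAM2 : A = M2 := by grind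
      have hM1B : M1 = B := by grind
      have hAA' : A' = A := by grind
      have hBB' : B' = B := by grind
      -- Now `m` claims the cell of `p` or that of `q`. The bump occurs both below and at the top of
      -- the cube, and puts `c` and `C` in the same column or the same row.
      rcases t1 with ⟨e1, e2⟩ | ⟨e1, e2⟩
      · right
        obtain ⟨d, hd, e⟩ := TL (e1 ▸ hA)
        obtain ⟨d', hd', e'⟩ := TL' A (hAM2 ▸ hM2) (hAA' ▸ hA')
        rw [C'.cell_unique hd', h1.cell_unique hd, e, e', e1]
      · left
        obtain ⟨d, hd, e⟩ := TR (e2 ▸ hM1B ▸ hB)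
        obtain ⟨d', hd', e'⟩ := TR' M1 hM1 (hM1B ▸ hBB' ▸ hB')
        rw [hC.cell_unique hd', h2.cell_unique hd, e, e', e2]
  · obtain ⟨c1, k1, k2⟩ := wordShape_append hw
    obtain ⟨c2, k3, k4⟩ := wordShape_append hwq
    have hlt' : ∀ a ∈ p :: w, a < m := fun a ha =>
      hlt a (by simpa using (List.mem_cons.1 ha).imp_right Or.inl) fun h => hq1 (h ▸ ha)
    have := h2.cell_unique k3
    refine ⟨c1, k1, Or.inl ?_⟩
    rw [k2 hlt', this, k4 fun a ha => hlt' a (by simp [ha])]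

theorem wordShape_local_rule {p q : α} {w : List α} (hw : (p :: w ++ [q]).Nodup) :
    (∀ ν : YoungDiagram, ν ≠ wordShape (p :: w) → wordShape w < ν →
      ν < wordShape (p :: w ++ [q]) → wordShape (w ++ [q]) = ν) ∧
    ((¬ ∃ ν : YoungDiagram, ν ≠ wordShape (p :: w) ∧ wordShape w < ν ∧
      ν < wordShape (p :: w ++ [q])) → wordShape (w ++ [q]) = wordShape (p :: w)) := by
  obtain ⟨a, ha, -⟩ := wordShape_cons (nodup_of_append_singleton hw).1
  obtain ⟨b, hb, -⟩ := wordShape_append (List.Nodup.of_cons hw : (w ++ [q]).Nodup)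
  obtain ⟨a', ha', -⟩ := wordShape_append hw
  obtain ⟨b', hb', -⟩ := wordShape_cons (show (p :: (w ++ [q])).Nodup from hw)
  by_cases hab : a = b
  · subst hab
    obtain ⟨c', hc', hal⟩ := aligned_of_cons_eq_append hw ha hb
    exact ⟨fun ν hν h1 h2 => absurd (ha.between_of_aligned hc' hal h1 h2) hν,
      fun _ => hb.right_unique ha⟩
  · have hne : wordShape (w ++ [q]) ≠ wordShape (p :: w) := fun h =>
      hab (ha.cell_unique (h ▸ hb))
    refine ⟨fun ν hν h1 h2 => ?_, fun h => absurd ⟨_, hne, hb.lt, hb'.lt⟩ h⟩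
    obtain ⟨d, hd, rfl | rfl⟩ := ha.between ha' h1 h2
    · exact absurd (hd.right_unique ha) hν
    · rcases ha.two ha' hb hb' with ⟨h, -⟩ | ⟨-, h⟩
      · exact absurd h hab
      · subst h
        exact hb.right_unique hd

end Words
-- From permutation posets to words
theorem maxChainUnion_eq_greene {n : ℕ} (σ : Equiv.Perm (Fin n)) {l : List (Fin n)}
    (hl : l.Pairwise (· < ·)) (k : ℕ) :
    maxChainUnion (l.toFinset.image fun a => (a, σ a)) k = greene k (l.map σ) := by
  classical
  have hinj : Function.Injective fun a => (a, σ a) := fun a b h => (Prod.mk.inj h).1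
  have hnd : l.Nodup := hl.imp ne_of_lt
  have hcount : ∀ g : Fin n → ℕ, (l.map σ).countP (fun x => g x < k) =
      ((l.toFinset.filter fun a => g (σ a) < k).image fun a => (a, σ a)).card := by
    intro g
    rw [List.countP_map, Finset.card_image_of_injective _ hinj, ← countP_eq_card hnd]
    rfl
  unfold maxChainUnion
  apply le_antisymm
  · refine csSup_le ⟨_, fun _ => ∅, by simp, rfl⟩ ?_
    rintro m ⟨C, hC, rfl⟩
    -- The chains may overlap; each covered letter chooses one of them, and `k` marks the uncovered
    -- letters.
    let g : Fin n → ℕ := fun v =>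
      if h : ∃ t : Fin k, (σ.symm v, v) ∈ C t then (h.choose : ℕ) else k
    have hg : ∀ a b, g (σ a) = g (σ b) → g (σ a) < k → ∃ t, (a, σ a) ∈ C t ∧ (b, σ b) ∈ C t := by
      intro a b e hk
      have hk' := e ▸ hk
      have hd : ∀ a, g (σ a) < k → ∃ t : Fin k, (a, σ a) ∈ C t ∧ (t : ℕ) = g (σ a) := by
        intro a ha
        by_cases h : ∃ t : Fin k, (σ.symm (σ a), σ a) ∈ C t
        · refine ⟨h.choose, by simpa using h.choose_spec, ?_⟩
          simp only [g]
          rw [dif_pos h]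
        · simp only [g] at ha
          rw [dif_neg h] at ha
          exact absurd ha (lt_irrefl _)
      obtain ⟨t, ht, et⟩ := hd a hk
      obtain ⟨s, hs, es⟩ := hd b hk'
      have : t = s := Fin.ext (by omega)
      subst this
      exact ⟨t, ht, hs⟩
    have hcol : IsChainColoring k (l.map σ) g := by
      unfold IsChainColoring
      rw [List.pairwise_map]
      refine hl.imp fun {a b} hab e hk => ?_
      obtain ⟨t, h1, h2⟩ := hg a b e hk
      have hne : (a, σ a) ≠ (b, σ b) := fun h => hab.ne (Prod.mk.inj h).1
      refine lt_of_le_of_ne ?_ fun h => hab.ne (σ.injective h)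
      rcases (hC t).2 h1 h2 hne with h | h
      · exact h.2
      · exact absurd h.1 (not_le.2 hab)
    refine le_trans ?_ hcol.le_greene
    rw [hcount]
    apply Finset.card_le_card
    intro p hp
    obtain ⟨t, -, ht⟩ := Finset.mem_biUnion.1 hp
    obtain ⟨a, ha, rfl⟩ := Finset.mem_image.1 ((hC t).1 ht)
    refine Finset.mem_image_of_mem _ (Finset.mem_filter.2 ⟨ha, ?_⟩)
    have h : ∃ t : Fin k, (σ.symm (σ a), σ a) ∈ C t := ⟨t, by simpa using ht⟩
    simp only [g]
    rw [dif_pos h]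
    exact h.choose.2
  · rw [greene_le_iff]
    intro g hg
    refine le_csSup ⟨(l.toFinset.image fun a => (a, σ a)).card, ?_⟩
      ⟨fun t => (l.toFinset.image fun a => (a, σ a)).filter fun p => g p.2 = t, ?_, ?_⟩
    · rintro m ⟨C, hC, rfl⟩
      exact Finset.card_le_card (Finset.biUnion_subset.2 fun t _ => (hC t).1)
    · intro t
      refine ⟨Finset.filter_subset _ _, ?_⟩
      have key := hg
      unfold IsChainColoring at key
      rw [List.pairwise_map] at key
      have key2 := (hl.and key).imp (S := fun a b => g (σ a) = t → g (σ b) = t →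
        ((a, σ a) ≤ (b, σ b) ∨ (b, σ b) ≤ (a, σ a))) fun h e1 e2 =>
          Or.inl ⟨h.1.le, (h.2 (e1.trans e2.symm) (e1 ▸ t.2)).le⟩
      have : Std.Symm fun a b => g (σ a) = t → g (σ b) = t →
        ((a, σ a) ≤ (b, σ b) ∨ (b, σ b) ≤ (a, σ a)) := ⟨fun a b h e1 e2 => (h e2 e1).symm⟩
      intro p hp q hq hne
      simp only [Finset.coe_filter, Finset.mem_image, List.mem_toFinset, Set.mem_ofPred_eq] at hp hq
      obtain ⟨⟨a, ha, rfl⟩, hga⟩ := hp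
      obtain ⟨⟨b, hb, rfl⟩, hgb⟩ := hq
      exact key2.forall ha hb (fun h => hne (by rw [h])) hga hgb
    · rw [hcount]
      congr 1
      ext p
      simp only [Finset.mem_image, Finset.mem_filter, List.mem_toFinset, Finset.mem_biUnion,
        Finset.mem_univ, true_and]
      constructor
      · rintro ⟨a, ⟨ha, hk⟩, rfl⟩
        exact ⟨⟨g (σ a), hk⟩, ⟨a, ha, rfl⟩, rfl⟩
      · rintro ⟨t, ⟨a, ha, rfl⟩, e⟩
        have e : g (σ a) = t := e
        exact ⟨a, ⟨ha, e ▸ t.2⟩, rfl⟩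

/-- The cardinality hypothesis ensures that `μ` fits into the square to which `shape` confines its
cells. -/
theorem shape_eq_of_rowLen {α : Type*} [PartialOrder α] [DecidableEq α] {S : Finset α}
    {μ : YoungDiagram} (h : ∀ r, chainRow S r = μ.rowLen r) (hc : μ.card = S.card) :
    shape S = μ := by
  classical
  apply YoungDiagram.ext
  ext ⟨a, b⟩
  simp only [shape, Finset.mem_filter, Finset.mem_product, Finset.mem_range, h]
  rw [YoungDiagram.mem_cells]
  constructor
  · exact fun hb => YoungDiagram.mem_iff_lt_rowLen.2 (hb.2 a le_rfl)
  · intro hm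
    have h1 := YoungDiagram.mem_iff_lt_rowLen.1 hm
    have h2 := YoungDiagram.mem_iff_lt_colLen.1 hm
    have h3 : μ.rowLen a ≤ μ.card := by
      rw [YoungDiagram.rowLen_eq_card]
      exact Finset.card_le_card (Finset.filter_subset _ _)
    have h4 : μ.colLen b ≤ μ.card := by
      rw [YoungDiagram.colLen_eq_card]
      exact Finset.card_le_card (Finset.filter_subset _ _)
    exact ⟨⟨by omega, by omega⟩, fun r hr => h1.trans_le (μ.rowLen_anti r a hr)⟩

theorem wordShape_nil {α : Type*} [LinearOrder α] : wordShape ([] : List α) = ⊥ := by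
  apply HasShape.wordShape_eq
  have : ∀ k, greene k ([] : List α) = 0 := fun k =>
    Nat.le_zero.1 (greene_le_iff.2 fun g _ => by simp)
  simp [HasShape, this]

theorem card_wordShape {α : Type*} [LinearOrder α] {w : List α} (hw : w.Nodup) :
    (wordShape w).card = w.length := by
  induction w with
  | nil => simp [wordShape_nil, YoungDiagram.card]
  | cons x w ih =>
    obtain ⟨c, h, -⟩ := wordShape_cons hw
    rw [h.card, ih hw.of_cons, List.length_cons]

/-! ### Interval shapes of a permutation -/

section Interval

variable {n : ℕ}

/-- The positions `i, …, j` (counted from `1`), in increasing order. -/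
def intervalList (n i j : ℕ) : List (Fin n) :=
  (List.finRange n).filter fun k => i ≤ (k : ℕ) + 1 ∧ (k : ℕ) + 1 ≤ j

/-- The word `σ(i), …, σ(j)`. -/
def intervalWord (σ : Equiv.Perm (Fin n)) (i j : ℕ) : List (Fin n) :=
  (intervalList n i j).map σ

theorem mem_intervalList {i j : ℕ} {k : Fin n} :
    k ∈ intervalList n i j ↔ i ≤ (k : ℕ) + 1 ∧ (k : ℕ) + 1 ≤ j := by
  simp [intervalList]

theorem pairwise_intervalList (i j : ℕ) : (intervalList n i j).Pairwise (· < ·) :=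
  List.Pairwise.filter _ (List.pairwise_lt_finRange n)

theorem intervalList_eq_nil {i j : ℕ} (h : j < i) : intervalList n i j = [] := by
  rw [List.eq_nil_iff_forall_not_mem]
  intro k hk
  rw [mem_intervalList] at hk
  omega

theorem intervalList_succ {i j : ℕ} (hij : i ≤ j + 1) (hj : j < n) :
    intervalList n i (j + 1) = intervalList n i j ++ [⟨j, hj⟩] := by
  apply List.Pairwise.eq_of_mem_iff (pairwise_intervalList _ _)
  · rw [List.pairwise_append]
    refine ⟨pairwise_intervalList _ _, by simp, ?_⟩
    intro a ha b hb
    rw [mem_intervalList] at ha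
    rw [List.mem_singleton] at hb
    subst hb
    rw [Fin.lt_def]
    simp only
    omega
  · intro k
    simp only [List.mem_append, mem_intervalList, List.mem_singleton, Fin.ext_iff]
    omega

theorem intervalList_cons {i j : ℕ} (hij : i + 1 ≤ j) (hj : j ≤ n) :
    intervalList n (i + 1) j = ⟨i, by omega⟩ :: intervalList n (i + 2) j := by
  apply List.Pairwise.eq_of_mem_iff (pairwise_intervalList _ _)
  · rw [List.pairwise_cons]
    refine ⟨?_, pairwise_intervalList _ _⟩
    intro a ha
    rw [mem_intervalList] at ha
    rw [Fin.lt_def]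
    simp only
    omega
  · intro k
    simp only [List.mem_cons, mem_intervalList, Fin.ext_iff]
    omega

theorem permInterval_eq (σ : Equiv.Perm (Fin n)) (i j : ℕ) :
    permInterval σ i j = (intervalList n i j).toFinset.image fun a => (a, σ a) := by
  unfold permInterval
  congr 1
  ext k
  simp [mem_intervalList]

theorem nodup_intervalWord (σ : Equiv.Perm (Fin n)) (i j : ℕ) : (intervalWord σ i j).Nodup :=
  List.Nodup.map σ.injective ((pairwise_intervalList i j).imp ne_of_lt)

theorem chainRow_permInterval (σ : Equiv.Perm (Fin n)) (i j r : ℕ) :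
    chainRow (permInterval σ i j) r = (wordShape (intervalWord σ i j)).rowLen r := by
  unfold chainRow
  rw [permInterval_eq, maxChainUnion_eq_greene σ (pairwise_intervalList i j),
    maxChainUnion_eq_greene σ (pairwise_intervalList i j)]
  have := (hasShape_wordShape (nodup_intervalWord σ i j)).greene_succ r
  unfold intervalWord at this ⊢
  omega

theorem intervalShape_eq (σ : Equiv.Perm (Fin n)) (i j : ℕ) :
    intervalShape σ i j = wordShape (intervalWord σ i j) := by
  apply shape_eq_of_rowLen (chainRow_permInterval σ i j)
  rw [card_wordShape (nodup_intervalWord σ i j), permInterval_eq,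
    Finset.card_image_of_injective _ fun a b h => (Prod.mk.inj h).1,
    List.toFinset_card_of_nodup ((pairwise_intervalList i j).imp ne_of_lt), intervalWord,
    List.length_map]

theorem intervalShape_eq_bot (σ : Equiv.Perm (Fin n)) {i j : ℕ} (h : j < i) :
    intervalShape σ i j = ⊥ := by
  rw [intervalShape_eq, intervalWord, intervalList_eq_nil h, List.map_nil, wordShape_nil]

theorem addBox_intervalShape (σ : Equiv.Perm (Fin n)) {i j : ℕ} (hij : i ≤ j + 1) (hj : j < n) :
    ∃ c, AddBox (intervalShape σ i j) c (intervalShape σ i (j + 1)) := by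
  have := nodup_intervalWord σ i (j + 1)
  rw [intervalShape_eq, intervalShape_eq]
  rw [intervalWord, intervalList_succ hij hj, List.map_append] at this
  rw [intervalWord, intervalWord, intervalList_succ hij hj, List.map_append]
  obtain ⟨c, h, -⟩ := wordShape_append this
  exact ⟨c, h⟩

theorem intervalShape_local_rule (σ : Equiv.Perm (Fin n)) {i j : ℕ} (hi : 1 < i) (hij : i ≤ j)
    (hj : j < n) :
    (∀ ν : YoungDiagram, ν ≠ intervalShape σ (i - 1) j → intervalShape σ i j < ν →
      ν < intervalShape σ (i - 1) (j + 1) → intervalShape σ i (j + 1) = ν) ∧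
    ((¬ ∃ ν : YoungDiagram, ν ≠ intervalShape σ (i - 1) j ∧ intervalShape σ i j < ν ∧
      ν < intervalShape σ (i - 1) (j + 1)) →
        intervalShape σ i (j + 1) = intervalShape σ (i - 1) j) := by
  obtain ⟨i, rfl⟩ : ∃ i', i = i' + 2 := ⟨i - 2, by omega⟩
  simp only [intervalShape_eq, intervalWord]
  have h1 : intervalList n (i + 2 - 1) j = ⟨i, by omega⟩ :: intervalList n (i + 2) j :=
    intervalList_cons (by omega) hj.le
  have h2 : intervalList n (i + 2 - 1) (j + 1) =
      ⟨i, by omega⟩ :: intervalList n (i + 2) j ++ [⟨j, hj⟩] := by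
    rw [← h1]
    exact intervalList_succ (by omega) hj
  have hn := nodup_intervalWord σ (i + 2 - 1) (j + 1)
  rw [intervalWord, h2] at hn
  rw [h1, h2, intervalList_succ (by omega) hj]
  simp only [List.map_append, List.map_cons, List.map_nil] at hn ⊢
  exact wordShape_local_rule hn

theorem intervalWord_rotate (σ : Equiv.Perm (Fin n)) {k : ℕ} (hk : k ≤ n) :
    intervalWord (rotate σ) 1 k = (intervalWord σ (n + 1 - k) n).reverse.map Fin.rev := by
  have : intervalList n 1 k = (intervalList n (n + 1 - k) n).reverse.map Fin.rev := by
    apply List.Pairwise.eq_of_mem_iff (pairwise_intervalList _ _)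
    · rw [List.pairwise_map, List.pairwise_reverse]
      exact (pairwise_intervalList _ _).imp fun h => Fin.rev_lt_rev.2 h
    · intro a
      simp only [List.mem_map, List.mem_reverse, mem_intervalList]
      constructor
      · intro h
        refine ⟨a.rev, ?_, Fin.rev_rev a⟩
        rw [Fin.val_rev]
        omega
      · rintro ⟨b, hb, rfl⟩
        rw [Fin.val_rev]
        omega
  unfold intervalWord
  rw [this, ← List.map_reverse, List.map_map, List.map_map]
  apply List.map_congr_left
  intro a _
  simp [rotate]

theorem intervalShape_rotate (σ : Equiv.Perm (Fin n)) {k : ℕ} (hk : k ≤ n) :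
    intervalShape (rotate σ) 1 k = intervalShape σ (n + 1 - k) n := by
  rw [intervalShape_eq, intervalShape_eq]
  apply ext_rowLen
  intro r
  have h1 := (hasShape_wordShape (nodup_intervalWord (rotate σ) 1 k)).greene_succ r
  have h2 := (hasShape_wordShape (nodup_intervalWord σ (n + 1 - k) n)).greene_succ r
  have h3 : ∀ m, greene m (intervalWord (rotate σ) 1 k) =
      greene m (intervalWord σ (n + 1 - k) n) := fun m => by
    rw [intervalWord_rotate σ hk, greene_reverse_map (f := Fin.rev) fun a b h =>
      Fin.rev_lt_rev.2 h]
  rw [h3, h3] at h1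
  omega

end Interval

/-! ### Growth sequences and standard tableaux -/

/-- The shapes `μ 0, …, μ n` start with the empty shape and grow by one box at a time. -/
def IsGrowth (n : ℕ) (μ : ℕ → YoungDiagram) : Prop :=
  μ 0 = ⊥ ∧ ∀ k < n, ∃ c, AddBox (μ k) c (μ (k + 1))

theorem IsGrowth.mono {n : ℕ} {μ : ℕ → YoungDiagram} (h : IsGrowth n μ) {k l : ℕ} (hkl : k ≤ l)
    (hl : l ≤ n) : μ k ≤ μ l := by
  induction l, hkl using Nat.le_induction with
  | base => exact le_rfl
  | succ l hkl ih =>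
    obtain ⟨c, hc⟩ := h.2 l (by omega)
    exact (ih (by omega)).trans hc.le

theorem IsGrowth.exists_encodes {n : ℕ} {μ : ℕ → YoungDiagram} (h : IsGrowth n μ) :
    ∃ T : StandardTableau n, T.Encodes μ := by
  classical
  -- The entry of a cell is the time at which it first appears.
  let e : ℕ × ℕ → ℕ := fun c => if c ∈ μ n then sInf {k | c ∈ μ k} else 0
  have mem_e : ∀ c ∈ μ n, c ∈ μ (e c) := by
    intro c hc
    simp only [e]
    rw [if_pos hc]
    exact Nat.sInf_mem (s := {k | c ∈ μ k}) ⟨n, hc⟩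
  have e_le : ∀ c ∈ μ n, ∀ k, c ∈ μ k → e c ≤ k := by
    intro c hc k hk
    simp only [e]
    rw [if_pos hc]
    exact Nat.sInf_le hk
  have e_pos : ∀ c ∈ μ n, 1 ≤ e c := by
    intro c hc
    by_contra h0
    have := mem_e c hc
    rw [show e c = 0 by omega, h.1] at this
    simp at this
  have mono_e : ∀ c ∈ μ n, ∀ d ≤ c, e d ≤ e c := by
    intro c hc d hd
    have hm := (μ (e c)).isLowerSet hd (mem_e c hc)
    exact e_le d ((μ n).isLowerSet hd hc) _ hm
  have inj : ∀ c ∈ μ n, ∀ d ∈ μ n, e c = e d → c = d := by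
    intro c hc d hd hcd
    have h1 := e_pos c hc
    obtain ⟨k, hk⟩ : ∃ k, e c = k + 1 := ⟨e c - 1, by omega⟩
    have hn := e_le c hc n hc
    obtain ⟨b, hb⟩ := h.2 k (by omega)
    have key : ∀ c ∈ μ n, e c = k + 1 → c = b := by
      intro c hc hk
      have := mem_e c hc
      rw [hk, hb.mem_iff] at this
      refine this.resolve_right fun h => ?_
      have := e_le c hc k h
      omega
    rw [key c hc hk, key d hd (hcd ▸ hk)]
  refine ⟨{ diagram := μ n, entry := e, bijOn := ⟨?_, ?_, ?_⟩, row_lt := ?_, col_lt := ?_,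
            zeros := ?_ }, ?_⟩
  · exact fun c hc => ⟨e_pos c hc, e_le c hc n hc⟩
  · exact fun c hc d hd hcd => inj c hc d hd hcd
  · rintro k ⟨h1, h2⟩
    obtain ⟨k, rfl⟩ : ∃ k', k = k' + 1 := ⟨k - 1, by omega⟩
    obtain ⟨b, hb⟩ := h.2 k (by omega)
    have hb1 : b ∈ μ (k + 1) := hb.mem_iff.2 (Or.inl rfl)
    have hbn : b ∈ μ n := h.mono h2 le_rfl hb1
    refine ⟨b, hbn, le_antisymm (e_le b hbn _ hb1) ?_⟩
    by_contra hlt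
    have hen := e_le b hbn n hbn
    exact hb.notMem (h.mono (k := e b) (l := k) (by omega) (by omega) (mem_e b hbn))
  · intro r s t hst hc
    have hle : (r, s) ≤ (r, t) := ⟨le_rfl, hst.le⟩
    refine lt_of_le_of_ne (mono_e _ hc _ hle) fun heq => ?_
    have := inj _ ((μ n).isLowerSet hle hc) _ hc heq
    simp at this
    omega
  · intro q r s hqr hc
    have hle : (q, s) ≤ (r, s) := ⟨hqr.le, le_rfl⟩
    refine lt_of_le_of_ne (mono_e _ hc _ hle) fun heq => ?_
    have := inj _ ((μ n).isLowerSet hle hc) _ hc heq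
    simp at this
    omega
  · intro c hc
    simp only [e]
    rw [if_neg hc]
  · intro k hk
    apply YoungDiagram.ext
    ext c
    simp only [StandardTableau.sub, Finset.mem_filter, YoungDiagram.mem_cells]
    constructor
    · rintro ⟨h1, h2⟩
      exact h.mono h2 hk (mem_e c h1)
    · intro hc
      have := h.mono hk le_rfl hc
      exact ⟨this, e_le c this k hc⟩

theorem StandardTableau.mem_sub {n : ℕ} (T : StandardTableau n) {k : ℕ} {c : ℕ × ℕ} :
    c ∈ T.sub k ↔ c ∈ T.diagram ∧ T.entry c ≤ k := by
  rw [← YoungDiagram.mem_cells, sub, Finset.mem_filter, YoungDiagram.mem_cells]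

theorem StandardTableau.isGrowth_sub {n : ℕ} (T : StandardTableau n) : IsGrowth n T.sub := by
  constructor
  · apply YoungDiagram.ext
    ext c
    rw [YoungDiagram.mem_cells, T.mem_sub]
    simp only [YoungDiagram.cells_bot, Finset.notMem_empty, iff_false, not_and]
    intro hc
    have := (T.bijOn.mapsTo hc).1
    omega
  · intro k hk
    obtain ⟨c, hc, e⟩ := T.bijOn.surjOn (show k + 1 ∈ Set.Icc 1 n from ⟨by omega, hk⟩)
    refine ⟨c, fun h => ?_, ?_⟩
    · have := (T.mem_sub.1 h).2
      omega
    · ext d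
      rw [Finset.mem_insert, YoungDiagram.mem_cells, YoungDiagram.mem_cells, T.mem_sub, T.mem_sub]
      constructor
      · rintro ⟨h1, h2⟩
        rcases Nat.lt_or_ge k (T.entry d) with h | h
        · exact Or.inl (T.bijOn.injOn h1 hc (by omega))
        · exact Or.inr ⟨h1, h⟩
      · rintro (rfl | h)
        · exact ⟨hc, e.le⟩
        · exact ⟨h.1, by omega⟩

theorem StandardTableau.sub_self {n : ℕ} (T : StandardTableau n) : T.sub n = T.diagram := by
  apply YoungDiagram.ext
  ext c
  rw [YoungDiagram.mem_cells, T.mem_sub, YoungDiagram.mem_cells]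
  exact ⟨fun h => h.1, fun h => ⟨h, (T.bijOn.mapsTo h).2⟩⟩

/-! ### The local rule on shapes -/

section LocalRule

variable {left bottom top : YoungDiagram}

theorem localRule_cases (left bottom top : YoungDiagram) :
    (localRule left bottom top ≠ left ∧ bottom < localRule left bottom top ∧
      localRule left bottom top < top) ∨
    (localRule left bottom top = left ∧
      ¬ ∃ ν : YoungDiagram, ν ≠ left ∧ bottom < ν ∧ ν < top) := by
  unfold localRule
  split_ifs with h
  · exact Or.inl h.choose_spec
  · exact Or.inr ⟨rfl, h⟩

theorem AddBox.localRule_left {a b : ℕ × ℕ} (h : AddBox bottom a left) (h1 : AddBox left b top) :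
    ∃ c, AddBox bottom c (localRule left bottom top) := by
  rcases localRule_cases left bottom top with ⟨-, h2, h3⟩ | ⟨e, -⟩
  · obtain ⟨d, hd, -⟩ := h.between h1 h2 h3
    exact ⟨d, hd⟩
  · rw [e]
    exact ⟨a, h⟩

theorem AddBox.localRule_right {a b : ℕ × ℕ} (h : AddBox bottom a left) (h1 : AddBox left b top) :
    ∃ c, AddBox (localRule left bottom top) c top := by
  rcases localRule_cases left bottom top with ⟨-, h2, h3⟩ | ⟨e, -⟩
  · obtain ⟨d, hd, -⟩ := h.between h1 h2 h3
    refine exists_of_le h3.le ?_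
    rw [h1.card, h.card, hd.card]
  · rw [e]
    exact ⟨b, h1⟩

/-- At most two shapes lie strictly between `bottom` and `top`; the rule exchanges two and fixes a
single one. -/
theorem AddBox.localRule_localRule {a b : ℕ × ℕ} (h : AddBox bottom a left)
    (h1 : AddBox left b top) : localRule (localRule left bottom top) bottom top = left := by
  rcases localRule_cases left bottom top with ⟨hne, h2, h3⟩ | ⟨e, -⟩
  · rcases localRule_cases (localRule left bottom top) bottom top with ⟨hne', h2', h3'⟩ | ⟨-, e'⟩
    · obtain ⟨d, hd, hd'⟩ := h.between h1 h2 h3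
      obtain ⟨d', hf, hf'⟩ := h.between h1 h2' h3'
      rcases hf' with rfl | rfl
      · exact hf.right_unique h
      · rcases hd' with rfl | rfl
        · exact absurd (hd.right_unique h) hne
        · exact absurd (hf.right_unique hd) hne'
    · exact absurd ⟨left, hne.symm, h.lt, h1.lt⟩ e'
  · rw [e, e]

theorem addBox_bot_oneBox : AddBox ⊥ (0, 0) oneBox :=
  ⟨by simp, by simp [oneBox]⟩

theorem AddBox.eq_oneBox {c : ℕ × ℕ} (h : AddBox ⊥ c left) : left = oneBox := by
  have hc : (c.1, c.2) ∈ left := h.mem_iff.2 (Or.inl rfl)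
  have h0 := left.up_left_mem (Nat.zero_le _) (Nat.zero_le _) hc
  rw [h.mem_iff] at h0
  have : (0, 0) = c := h0.resolve_right (by simp)
  subst this
  exact h.right_unique addBox_bot_oneBox

end LocalRule

/-! ### Growth arrays and their reflection -/

section GrowthArray

variable {n : ℕ} {μ : ℕ → YoungDiagram}

theorem growthArray_pred_self (hμ : IsGrowth n μ) {i : ℕ} (hi : 1 ≤ i) :
    growthArray μ i (i - 1) = ⊥ := by
  match i, hi with
  | 1, _ => exact hμ.1
  | i + 2, _ => simp [growthArray, nextRow]

theorem growthArray_self {i : ℕ} (hi : 1 ≤ i) : growthArray μ (i + 1) (i + 1) = oneBox := by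
  match i, hi with
  | i + 1, _ => simp [growthArray, nextRow]

theorem growthArray_of_lt {i j : ℕ} (hi : 1 ≤ i) (hij : i < j) :
    growthArray μ (i + 1) (j + 1) =
      localRule (growthArray μ i j) (growthArray μ (i + 1) j) (growthArray μ i (j + 1)) := by
  match i, hi with
  | i + 1, _ =>
    simp only [growthArray]
    rw [nextRow, if_neg (by omega), if_neg (by omega)]

/-- Every row of the array grows by one box at a time. -/
theorem growthArray_row (hμ : IsGrowth n μ) {i : ℕ} (hi : 1 ≤ i) :
    (∀ j, i ≤ j + 1 → j < n → ∃ c, AddBox (growthArray μ i j) c (growthArray μ i (j + 1))) ∧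
    (∀ j, i ≤ j → j ≤ n → ∃ c, AddBox (growthArray μ (i + 1) j) c (growthArray μ i j)) ∧
    (∀ j, i ≤ j → j < n → growthArray μ (i + 1) (j + 1) =
      localRule (growthArray μ i j) (growthArray μ (i + 1) j) (growthArray μ i (j + 1))) := by
  have step : ∀ i, 1 ≤ i →
      (∀ j, i ≤ j + 1 → j < n → ∃ c, AddBox (growthArray μ i j) c (growthArray μ i (j + 1))) →
      (∀ j, i ≤ j → j ≤ n → ∃ c, AddBox (growthArray μ (i + 1) j) c (growthArray μ i j)) ∧
      (∀ j, i ≤ j → j < n → growthArray μ (i + 1) (j + 1) =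
        localRule (growthArray μ i j) (growthArray μ (i + 1) j) (growthArray μ i (j + 1))) := by
    intro i hi hrow
    have first : i ≤ n → ∃ c, AddBox (growthArray μ (i + 1) i) c (growthArray μ i i) := by
      intro hin
      have h1 := growthArray_pred_self hμ (i := i + 1) (by omega)
      obtain ⟨c, hc⟩ := hrow (i - 1) (by omega) (by omega)
      rw [growthArray_pred_self hμ hi, Nat.sub_add_cancel hi] at hc
      rw [show i + 1 - 1 = i by omega] at h1
      exact ⟨c, h1 ▸ hc⟩
    -- The prescribed single box on the diagonal also obeys the rule, with an empty bottom shape: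
    -- any box added to `⊥` gives `oneBox`.
    have rule : ∀ j, i ≤ j → j < n → growthArray μ (i + 1) (j + 1) =
        localRule (growthArray μ i j) (growthArray μ (i + 1) j) (growthArray μ i (j + 1)) := by
      intro j hij hj
      rcases hij.eq_or_lt with rfl | hij
      · have h1 := growthArray_pred_self hμ (i := i + 1) (by omega)
        rw [show i + 1 - 1 = i by omega] at h1
        obtain ⟨c, hc⟩ := first hj.le
        obtain ⟨d, hd⟩ := hrow i (by omega) hj
        obtain ⟨e, he⟩ := hc.localRule_left hd
        rw [growthArray_self hi]
        rw [h1] at he ⊢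
        exact he.eq_oneBox.symm
      · exact growthArray_of_lt hi hij
    refine ⟨fun j hij => ?_, rule⟩
    induction j, hij using Nat.le_induction with
    | base => exact first
    | succ j hij ih =>
      intro hj
      obtain ⟨c, hc⟩ := ih (by omega)
      obtain ⟨d, hd⟩ := hrow j (by omega) (by omega)
      rw [rule j hij (by omega)]
      exact hc.localRule_right hd
  have main : ∀ j, i ≤ j + 1 → j < n →
      ∃ c, AddBox (growthArray μ i j) c (growthArray μ i (j + 1)) := by
    induction i, hi using Nat.le_induction with
    | base => exact fun j _ hj => hμ.2 j hj
    | succ i hi ih =>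
      intro j hij hj
      obtain ⟨h1, h2⟩ := step i hi ih
      obtain ⟨c, hc⟩ := h1 j (by omega) hj.le
      obtain ⟨d, hd⟩ := ih j (by omega) hj
      rw [h2 j (by omega) hj]
      exact hc.localRule_left hd
  exact ⟨main, step i hi main⟩

/-- The last column of the array, read upwards. -/
theorem isGrowth_lastColumn (hμ : IsGrowth n μ) :
    IsGrowth n fun k => growthArray μ (n + 1 - k) n := by
  refine ⟨?_, fun k hk => ?_⟩
  · simpa using growthArray_pred_self hμ (i := n + 1) (by omega)
  · obtain ⟨c, hc⟩ := (growthArray_row hμ (i := n - k) (by omega)).2.1 n (by omega) le_rfl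
    refine ⟨c, ?_⟩
    simp only
    rwa [show n + 1 - k = n - k + 1 by omega, show n + 1 - (k + 1) = n - k by omega]

/-- The array started from the last column is the reflected array. -/
theorem growthArray_reflect (hμ : IsGrowth n μ) {ν : ℕ → YoungDiagram}
    (hν : ∀ k ≤ n, ν k = growthArray μ (n + 1 - k) n) {i j : ℕ} (hi : 1 ≤ i) (hij : i ≤ j + 1)
    (hj : j ≤ n) : growthArray ν i j = growthArray μ (n + 1 - j) (n + 1 - i) := by
  have hνg : IsGrowth n ν := by
    have := isGrowth_lastColumn hμ
    refine ⟨(hν 0 (by omega)).trans this.1, fun k hk => ?_⟩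
    obtain ⟨c, hc⟩ := this.2 k hk
    rw [hν k hk.le, hν (k + 1) hk]
    exact ⟨c, hc⟩
  induction i, hi using Nat.le_induction generalizing j with
  | base => exact hν j hj
  | succ i hi ih =>
    replace hij : i ≤ j := by omega
    induction j, hij using Nat.le_induction with
    | base =>
      have h1 := growthArray_pred_self hνg (i := i + 1) (by omega)
      have h2 := growthArray_pred_self hμ (i := n + 1 - i) (by omega)
      rw [show i + 1 - 1 = i by omega] at h1
      rw [show n + 1 - i - 1 = n + 1 - (i + 1) by omega] at h2
      rw [h1, h2]
    | succ j hij ihj =>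
      rw [(growthArray_row hνg hi).2.2 j hij (by omega), ih (by omega) (by omega),
        ih (by omega) hj, ihj (by omega)]
      -- Reflection keeps bottom and top of each small square and interchanges its other two
      -- corners, so the self-inverse rule also computes the reflected array.
      have hrow := growthArray_row hμ (i := n - j) (by omega)
      obtain ⟨c, hc⟩ := hrow.2.1 (n - i) (by omega) (by omega)
      obtain ⟨d, hd⟩ := hrow.1 (n - i) (by omega) (by omega)
      have h3 := hc.localRule_localRule hd
      rw [← hrow.2.2 (n - i) (by omega) (by omega)] at h3
      rw [show n + 1 - j = n - j + 1 by omega, show n + 1 - i = n - i + 1 by omega,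
        show n + 1 - (i + 1) = n - i by omega, show n + 1 - (j + 1) = n - j by omega]
      exact h3

theorem growthArray_eq_intervalShape (σ : Equiv.Perm (Fin n))
    (hμ : ∀ k ≤ n, μ k = intervalShape σ 1 k) {i j : ℕ} (hi : 1 ≤ i) (hij : i ≤ j + 1)
    (hj : j ≤ n) : growthArray μ i j = intervalShape σ i j := by
  have hμg : IsGrowth n μ := by
    refine ⟨(hμ 0 (by omega)).trans (intervalShape_eq_bot σ (by omega)), fun k hk => ?_⟩
    rw [hμ k hk.le, hμ (k + 1) hk]
    exact addBox_intervalShape σ (by omega) hk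
  induction i, hi using Nat.le_induction generalizing j with
  | base => exact hμ j hj
  | succ i hi ih =>
    replace hij : i ≤ j := by omega
    have base : growthArray μ (i + 1) i = ⊥ := by
      have h1 := growthArray_pred_self hμg (i := i + 1) (by omega)
      rwa [show i + 1 - 1 = i by omega] at h1
    induction j, hij using Nat.le_induction with
    | base => rw [base, intervalShape_eq_bot σ (by omega)]
    | succ j hij ihj =>
      rcases hij.eq_or_lt with rfl | hij
      · obtain ⟨c, hc⟩ := addBox_intervalShape σ (i := i + 1) (j := i) le_rfl (by omega)
        rw [intervalShape_eq_bot σ (by omega)] at hc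
        rw [growthArray_self hi, hc.eq_oneBox]
      · rw [(growthArray_row hμg hi).2.2 j (by omega) (by omega), ih (by omega) (by omega),
          ih (by omega) hj, ihj (by omega)]
        have hr := intervalShape_local_rule σ (i := i + 1) (j := j) (by omega) (by omega) (by omega)
        rw [Nat.add_sub_cancel] at hr
        rcases localRule_cases (intervalShape σ i j) (intervalShape σ (i + 1) j)
          (intervalShape σ i (j + 1)) with ⟨h1, h2, h3⟩ | ⟨h1, h2⟩
        · exact (hr.1 _ h1 h2 h3).symm
        · rw [h1]
          exact (hr.2 h2).symm

end GrowthArray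

end PosetGrowth

/-! ### The theorem -/

theorem theorem4p1 (n : ℕ) :
    -- the shapes are well defined: the rows of the Young diagram have the prescribed lengths
    (∀ (σ : Equiv.Perm (Fin n)) (i j r : ℕ),
      (PosetGrowth.intervalShape σ i j).rowLen r =
        PosetGrowth.chainRow (PosetGrowth.permInterval σ i j) r) ∧
    -- the local growth rule
    (∀ (σ : Equiv.Perm (Fin n)) (i j : ℕ), 1 < i → i ≤ j → j < n →
      (∀ ν : YoungDiagram, ν ≠ PosetGrowth.intervalShape σ (i - 1) j →
        PosetGrowth.intervalShape σ i j < ν →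
        ν < PosetGrowth.intervalShape σ (i - 1) (j + 1) →
          PosetGrowth.intervalShape σ i (j + 1) = ν) ∧
      ((¬ ∃ ν : YoungDiagram, ν ≠ PosetGrowth.intervalShape σ (i - 1) j ∧
        PosetGrowth.intervalShape σ i j < ν ∧
        ν < PosetGrowth.intervalShape σ (i - 1) (j + 1)) →
          PosetGrowth.intervalShape σ i (j + 1) = PosetGrowth.intervalShape σ (i - 1) j)) ∧
    -- the tableaux `Q(σ)`, `Q'(σ)` and the involution computed by the growth rule
    (∃ (Q Q' : Equiv.Perm (Fin n) → PosetGrowth.StandardTableau n)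
        (ev : PosetGrowth.StandardTableau n → PosetGrowth.StandardTableau n),
      (∀ σ, (Q σ).Encodes fun k => PosetGrowth.intervalShape σ 1 k) ∧
      (∀ σ, (Q' σ).Encodes fun k => PosetGrowth.intervalShape σ (n + 1 - k) n) ∧
      (∀ T, (ev T).Encodes fun k => PosetGrowth.growthArray T.sub (n + 1 - k) n) ∧
      (∀ σ, Q' σ = Q (PosetGrowth.rotate σ)) ∧
      (∀ σ i j, 1 ≤ i → i ≤ j → j ≤ n →
        PosetGrowth.growthArray (Q σ).sub i j = PosetGrowth.intervalShape σ i j) ∧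
      (∀ σ, ev (Q σ) = Q' σ) ∧
      (∀ T, (ev T).diagram = T.diagram) ∧
      Function.Involutive ev) := by
  refine ⟨fun σ i j r => ?_, fun σ i j hi hij hj =>
    PosetGrowth.intervalShape_local_rule σ hi hij hj, ?_⟩
  · rw [PosetGrowth.intervalShape_eq, PosetGrowth.chainRow_permInterval]
  have hQ : ∀ σ : Equiv.Perm (Fin n), ∃ T : PosetGrowth.StandardTableau n,
      T.Encodes fun k => PosetGrowth.intervalShape σ 1 k := fun σ =>
    PosetGrowth.IsGrowth.exists_encodes ⟨PosetGrowth.intervalShape_eq_bot σ (by omega),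
      fun k hk => PosetGrowth.addBox_intervalShape σ (by omega) hk⟩
  have hev : ∀ T : PosetGrowth.StandardTableau n, ∃ U : PosetGrowth.StandardTableau n,
      U.Encodes fun k => PosetGrowth.growthArray T.sub (n + 1 - k) n := fun T =>
    (PosetGrowth.isGrowth_lastColumn T.isGrowth_sub).exists_encodes
  choose Q hQ using hQ
  choose ev hev using hev
  have hQ' : ∀ σ, (Q (PosetGrowth.rotate σ)).Encodes
      fun k => PosetGrowth.intervalShape σ (n + 1 - k) n := fun σ k hk =>
    (hQ (PosetGrowth.rotate σ) k hk).trans (PosetGrowth.intervalShape_rotate σ hk)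
  -- The range includes $i=j+1$, as $Q'(\sigma)$ at $k=0$ refers to the empty interval $[n+1;n]$.
  have harray : ∀ σ i j, 1 ≤ i → i ≤ j + 1 → j ≤ n →
      PosetGrowth.growthArray (Q σ).sub i j = PosetGrowth.intervalShape σ i j :=
    fun σ i j hi hij hj => PosetGrowth.growthArray_eq_intervalShape σ (hQ σ) hi hij hj
  refine ⟨Q, fun σ => Q (PosetGrowth.rotate σ), ev, hQ, hQ', hev, fun _ => rfl,
    fun σ i j hi hij hj => harray σ i j hi (by omega) hj, fun σ => ?_, fun T => ?_, fun T => ?_⟩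
  · refine (hev (Q σ)).unique fun k hk => ?_
    exact (hQ' σ k hk).trans (harray σ (n + 1 - k) n (by omega) (by omega) le_rfl).symm
  · have h := hev T n le_rfl
    simp only [Nat.add_sub_cancel_left] at h
    rw [← (ev T).sub_self, h, ← T.sub_self]
    rfl
  · refine (hev (ev T)).unique fun k hk => ?_
    simp only
    -- The last column of the reflected array is the first row of the original one, which is
    -- `T.sub`.
    rw [PosetGrowth.growthArray_reflect T.isGrowth_sub (hev T) (by omega) (by omega) le_rfl,
      Nat.add_sub_cancel_left, Nat.sub_sub_self (by omega)]
    rfl
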